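/- Conventions. A $\mathbb{Z}_2$-manifold (supermanifold) $M=(|M|,\mathcal{O}_M)$ of dimension $m|n$ is a second-countable Hausdorff space with a sheaf of $\mathbb{Z}_2$-graded, $\mathbb{Z}_2$-commutative, associative unital $\mathbb{R}$-algebras with local stalks, locally isomorphic to $\mathbb{R}^{m|n}=(\mathbb{R}^m, C^\infty\otimes\Lambda\mathbb{R}^n)$. Write $\mathcal{T}M(U)=\mathrm{Der}(\mathcal{O}_M(U))$ for the $\mathbb{Z}_2$-graded derivations, $C^\infty(M)=\mathcal{O}_M(|M|)$, $\mathrm{Vect}(M)=\mathcal{T}M(|M|)$, $|\cdot|\in\mathbb{Z}_2$ for degrees, and $[X,Y]=XY-(-1)^{|X||Y|}YX$. A Riemannian metric $g=\langle -,-\rangle_g$ is a morphism of sheaves $\mathcal{T}M\otimes\mathcal{T}M\to\mathcal{O}_M$, homogeneous of a degree $|g|\in\mathbb{Z}_2$ (so $|\langle X,Y\rangle_g|=|X|+|Y|+|g|$), with $\langle X,Y\rangle_g=(-1)^{|X||Y|}\langle Y,X\rangle_g$ and $\langle fX,Y\rangle_g=f\langle X,Y\rangle_g$, which is non-degenerate,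 i.e. $Y\mapsto\langle -,Y\rangle_g$ is a bijection from $\mathcal{T}M$ onto its $\mathcal{O}_M$-linear dual (over every open set). An affine connection is a bi-additive, degree-preserving map $\nabla:\mathrm{Vect}(M)\times\mathrm{Vect}(M)\to\mathrm{Vect}(M)$ with $\nabla_{fX}Y=f\nabla_XY$ and $\nabla_X(fY)=X(f)Y+(-1)^{|X||f|}f\nabla_XY$. Its torsion is $T_\nabla(X,Y)=\nabla_XY-(-1)^{|X||Y|}\nabla_YX-[X,Y]$, and it is metric compatible if $X\langle Y,Z\rangle_g=\langle\nabla_XY,Z\rangle_g+(-1)^{|X||Y|}\langle Y,\nabla_XZ\rangle_g$. The Levi-Civita connection $\nabla^L$ is the affine connection that is torsion-free and metric compatible. Put $X\cdot f=(-1)^{|X||f|}fX$. Formulas containing degrees are for homogeneous arguments. Theorem. Let $(M,g)$ be a Riemannian $\mathbb{Z}_2$-manifold and let $P\in\mathrm{Vect}(M)$ be homogeneous with $|P|=|g|$. There is exactly one affine connection $\nabla$ on $M$ such that, for all homogeneous $X,Y,Z\in\mathrm{Vect}(M)$, $$T_{\nabla}(X,Y)=X\cdot g(Y,P)-(-1)^{|X||Y|}\,Y\cdot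 g(X,P),$$ $$\langle\nabla_XY,Z\rangle_g+(-1)^{|X||Y|}\langle Y,\nabla_XZ\rangle_g = X\langle Y,Z\rangle_g+(-1)^{|X||Y|}g(Y,P)g(X,Z)+(-1)^{|X||Y|}(-1)^{|Z|(|X|+|Y|)}g(Z,P)g(Y,X).$$ An affine connection satisfies these two conditions if and only if it is the semi-symmetric non-metric connection $\widehat\nabla$, given by $\widehat{\nabla}_XY=\nabla^L_XY+X\cdot g(Y,P)$ for homogeneous $X,Y$. If $P\neq 0$, this connection is not metric compatible. -/

import Mathlib

open CategoryTheory Opposite TopologicalSpace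
open scoped Manifold ContDiff TensorProduct

universe u

noncomputable section

namespace SuperGeometry

/-! ### Supercommutative real algebras and their superderivations -/

/-- The sign `(-1)^{i j}` for parities `i, j ∈ ℤ/2`. -/
def sgn (i j : ZMod 2) : ℤ := (-1) ^ (i.val * j.val)

/-- `A = A₀ ⊕ A₁` is a `ℤ/2`-graded, `ℤ/2`-commutative, associative unital real algebra. -/
class SuperCommAlg {A : Type u} [Ring A] [Algebra ℝ A] (𝒜 : ZMod 2 → Submodule ℝ A) : Prop
    extends SetLike.GradedMonoid 𝒜 where
  isInternal : DirectSum.IsInternal 𝒜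
  super_comm : ∀ (i j : ZMod 2), ∀ a ∈ 𝒜 i, ∀ b ∈ 𝒜 j, a * b = sgn i j • (b * a)

section Derivations

variable {A : Type u} [Ring A] [Algebra ℝ A] (𝒜 : ZMod 2 → Submodule ℝ A)

/-- The superderivations of `A` that are homogeneous of degree `i`. -/
def derDeg (i : ZMod 2) : Submodule ℝ (A →ₗ[ℝ] A) where
  carrier := {D | (∀ j, ∀ a ∈ 𝒜 j, D a ∈ 𝒜 (i + j)) ∧
    ∀ j, ∀ a ∈ 𝒜 j, ∀ b, D (a * b) = D a * b + sgn i j • (a * D b)}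
  zero_mem' := by simp
  add_mem' := by
    rintro D E ⟨hD, hD'⟩ ⟨hE, hE'⟩
    refine ⟨fun j a ha => add_mem (hD j a ha) (hE j a ha), fun j a ha b => ?_⟩
    simp only [LinearMap.add_apply, hD' j a ha, hE' j a ha, mul_add, add_mul, smul_add]
    abel
  smul_mem' := by
    rintro c D ⟨hD, hD'⟩
    refine ⟨fun j a ha => Submodule.smul_mem _ _ (hD j a ha), fun j a ha b => ?_⟩
    simp only [LinearMap.smul_apply, hD' j a ha, smul_add, smul_mul_assoc, mul_smul_comm]
    rw [smul_comm c (sgn i j)]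

variable {𝒜}

lemma sgn_add_left (i j k : ZMod 2) : sgn (i + j) k = sgn i k * sgn j k := by
  revert i j k; decide

lemma sgn_add_right (i j k : ZMod 2) : sgn i (j + k) = sgn i j * sgn i k := by
  revert i j k; decide

lemma sgn_comm (i j : ZMod 2) : sgn i j = sgn j i := by
  revert i j; decide

lemma sgn_mul_self (i j : ZMod 2) : sgn i j * sgn i j = 1 := by
  revert i j; decide

lemma smul_mem_derDeg [SuperCommAlg 𝒜] {i j : ZMod 2} {f : A} (hf : f ∈ 𝒜 i)
    {D : A →ₗ[ℝ] A} (hD : D ∈ derDeg 𝒜 j) : f • D ∈ derDeg 𝒜 (i + j) := by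
  refine ⟨fun k a ha => ?_, fun k a ha b => ?_⟩
  · have := SetLike.GradedMul.mul_mem hf (hD.1 k a ha)
    simpa [add_assoc] using this
  · have hc : f * a = sgn i k • (a * f) := SuperCommAlg.super_comm i k f hf a ha
    simp only [LinearMap.smul_apply, smul_eq_mul, hD.2 k a ha b, mul_add, mul_smul_comm,
      ← mul_assoc, hc, smul_mul_assoc, smul_smul, sgn_add_left]
    rw [mul_comm (sgn j k)]

lemma exists_add_of_internal [SuperCommAlg 𝒜] (f : A) :
    ∃ f₀ ∈ 𝒜 0, ∃ f₁ ∈ 𝒜 1, f = f₀ + f₁ := by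
  have h : f ∈ ⨆ i, 𝒜 i := by
    rw [(SuperCommAlg.isInternal (𝒜 := 𝒜)).submodule_iSup_eq_top]; trivial
  have h2 : (⨆ i, 𝒜 i) ≤ 𝒜 0 ⊔ 𝒜 1 := by
    refine iSup_le fun i => ?_
    fin_cases i
    · exact le_sup_left
    · exact le_sup_right
  obtain ⟨a, ha, b, hb, rfl⟩ := Submodule.mem_sup.1 (h2 h)
  exact ⟨a, ha, b, hb, rfl⟩

variable (𝒜) in
/-- `Der(A) = Der(A)₀ ⊕ Der(A)₁`, as a left `A`-module via `(f D)(h) = f · D(h)`. -/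
def der [SuperCommAlg 𝒜] : Submodule A (A →ₗ[ℝ] A) where
  carrier := {D | ∃ D₀ ∈ derDeg 𝒜 0, ∃ D₁ ∈ derDeg 𝒜 1, D = D₀ + D₁}
  zero_mem' := ⟨0, zero_mem _, 0, zero_mem _, by simp⟩
  add_mem' := by
    rintro _ _ ⟨D₀, h₀, D₁, h₁, rfl⟩ ⟨E₀, k₀, E₁, k₁, rfl⟩
    exact ⟨_, add_mem h₀ k₀, _, add_mem h₁ k₁, by abel⟩
  smul_mem' := by
    rintro f _ ⟨D₀, h₀, D₁, h₁, rfl⟩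
    obtain ⟨f₀, hf₀, f₁, hf₁, rfl⟩ := exists_add_of_internal (𝒜 := 𝒜) f
    refine ⟨f₀ • D₀ + f₁ • D₁, add_mem ?_ ?_, f₀ • D₁ + f₁ • D₀, add_mem ?_ ?_, ?_⟩
    · simpa using smul_mem_derDeg hf₀ h₀
    · exact smul_mem_derDeg hf₁ h₁
    · simpa using smul_mem_derDeg hf₀ h₁
    · simpa using smul_mem_derDeg hf₁ h₀
    · simp only [add_smul, smul_add]; abel

lemma derDeg_le_der [SuperCommAlg 𝒜] {i : ZMod 2} {D : A →ₗ[ℝ] A} (hD : D ∈ derDeg 𝒜 i) :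
    D ∈ der 𝒜 := by
  fin_cases i
  · exact ⟨D, hD, 0, zero_mem _, by simp⟩
  · exact ⟨0, zero_mem _, D, hD, by simp⟩

/-- The supercommutator of homogeneous superderivations is a superderivation. -/
lemma bracket_mem_derDeg {i j : ZMod 2} {X Y : A →ₗ[ℝ] A}
    (hX : X ∈ derDeg 𝒜 i) (hY : Y ∈ derDeg 𝒜 j) :
    X ∘ₗ Y - sgn i j • (Y ∘ₗ X) ∈ derDeg 𝒜 (i + j) := by
  refine ⟨fun k a ha => ?_, fun k a ha b => ?_⟩
  · have h1 := hX.1 _ _ (hY.1 k a ha)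
    have h2 := hY.1 _ _ (hX.1 k a ha)
    rw [add_left_comm j i k] at h2
    rw [add_assoc]
    exact sub_mem h1 (zsmul_mem h2 _)
  · simp only [LinearMap.sub_apply, LinearMap.comp_apply, LinearMap.smul_apply, hX.2 k a ha b,
      hY.2 k a ha b, map_add, map_zsmul, hX.2 _ _ (hY.1 k a ha), hY.2 _ _ (hX.1 k a ha),
      hX.2 k a ha, hY.2 k a ha, sgn_add_left, sgn_add_right, sub_mul, mul_sub, smul_mul_assoc,
      mul_smul_comm, smul_add, smul_sub, smul_smul]
    have e1 : sgn i j * (sgn j i * sgn j k) = sgn j k := by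
      rw [sgn_comm j i, ← mul_assoc, sgn_mul_self, one_mul]
    have e2 : sgn i j * (sgn i k * sgn j k) = sgn i k * sgn j k * sgn i j := by ring
    rw [e1, e2, mul_comm (sgn j k) (sgn i k)]
    abel

end Derivations

/-! ### Locally `ℤ/2`-ringed spaces and supermanifolds -/

/-- A locally `ℤ/2`-ringed space: a second-countable Hausdorff space with a sheaf of `ℤ/2`-graded
`ℤ/2`-commutative associative unital real algebras whose stalks are local rings. -/
structure SuperRingedSpace where
  carrier : TopCat.{u}
  [t2 : T2Space carrier]
  [secondCountable : SecondCountableTopology carrier]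
  sheaf : TopCat.Sheaf (AlgCat.{u} ℝ) carrier
  /-- the even and odd sections over `U` -/
  gr : ∀ U : Opens carrier, ZMod 2 → Submodule ℝ (sheaf.presheaf.obj (op U))
  [superComm : ∀ U, SuperCommAlg (gr U)]
  map_gr : ∀ {U V : Opens carrier} (h : V ≤ U) (i : ZMod 2), ∀ f ∈ gr U i,
    (sheaf.presheaf.map (homOfLE h).op).hom f ∈ gr V i
  local_stalk : ∀ p : carrier,
    IsLocalRing (TopCat.Presheaf.stalk (C := RingCat.{u})
      (sheaf.presheaf ⋙ forget₂ (AlgCat.{u} ℝ) RingCat.{u}) p : RingCat.{u})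

attribute [instance] SuperRingedSpace.superComm

namespace SuperRingedSpace

variable (M : SuperRingedSpace.{u})

/-- The algebra of sections of the structure sheaf over `U`. -/
abbrev sec (U : Opens M.carrier) : Type u := M.sheaf.presheaf.obj (op U)

/-- Restriction of sections. -/
def res {U V : Opens M.carrier} (h : V ≤ U) : M.sec U →ₐ[ℝ] M.sec V :=
  (M.sheaf.presheaf.map (homOfLE h).op).hom

/-- Sections over `U` of the tangent sheaf: the superderivations of the algebra of sections
over `U`. -/
abbrev tangent (U : Opens M.carrier) : Type u := der (M.gr U)

/-- `X'` on `V` is the restriction of `X` on `U`. -/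
def IsRestriction {U V : Opens M.carrier} (h : V ≤ U) (X : M.tangent U) (X' : M.tangent V) :
    Prop :=
  ∀ f : M.sec U, X'.1 (M.res h f) = M.res h (X.1 f)

/-- The algebra of global functions. -/
abbrev Fn : Type u := M.sec ⊤

/-- The module of vector fields. -/
abbrev Vect : Type u := M.tangent ⊤

/-- `f` is a global function of degree `i`. -/
def FnDeg (i : ZMod 2) (f : M.Fn) : Prop := f ∈ M.gr ⊤ i

variable {M}

/-- The vector field (more generally, section of the tangent sheaf) `X` is of degree `i`. -/
def HasDeg {U : Opens M.carrier} (i : ZMod 2) (X : M.tangent U) : Prop := X.1 ∈ derDeg (M.gr U) i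

/-- The bracket `[X, Y] = X ∘ Y - (-1)^{|X||Y|} Y ∘ X` of homogeneous vector fields. -/
def bracket {i j : ZMod 2} {X Y : M.Vect} (hX : HasDeg i X) (hY : HasDeg j Y) : M.Vect :=
  ⟨X.1 ∘ₗ Y.1 - sgn i j • (Y.1 ∘ₗ X.1), derDeg_le_der (bracket_mem_derDeg hX hY)⟩

end SuperRingedSpace

/-- The coordinate space underlying `ℝ^{m|n}`. -/
abbrev E (m : ℕ) : Type := EuclideanSpace ℝ (Fin m)

/-- Sections over `W ⊆ ℝ^m` of the structure sheaf of `ℝ^{m|n}`: `C^∞(W) ⊗ Λ ℝ^n`. -/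
abbrev Model (m n : ℕ) (W : Opens (E m)) : Type :=
  C^∞⟮𝓘(ℝ, E m), W; ℝ⟯ ⊗[ℝ] ExteriorAlgebra ℝ (Fin n → ℝ)

/-- Restriction of smooth functions, as a homomorphism of algebras. -/
def smoothRes {m : ℕ} {V W : Opens (E m)} (h : V ≤ W) :
    C^∞⟮𝓘(ℝ, E m), W; ℝ⟯ →ₐ[ℝ] C^∞⟮𝓘(ℝ, E m), V; ℝ⟯ :=
  { ContMDiffMap.restrictRingHom 𝓘(ℝ, E m) 𝓘(ℝ) ℝ h with
    commutes' := fun _ => rfl }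

/-- Restriction of sections of the structure sheaf of `ℝ^{m|n}`. -/
def modelRes {m : ℕ} (n : ℕ) {V W : Opens (E m)} (h : V ≤ W) : Model m n W →ₐ[ℝ] Model m n V :=
  Algebra.TensorProduct.map (smoothRes h) (AlgHom.id ℝ _)

/-- The degree `i` part of `C^∞(W) ⊗ Λ ℝ^n` is `C^∞(W) ⊗ (Λ ℝ^n)_i`. -/
def modelGr (m n : ℕ) (W : Opens (E m)) (i : ZMod 2) : Submodule ℝ (Model m n W) :=
  LinearMap.range (LinearMap.lTensor C^∞⟮𝓘(ℝ, E m), W; ℝ⟯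
    (CliffordAlgebra.evenOdd (0 : QuadraticForm ℝ (Fin n → ℝ)) i).subtype)

/-- A superchart: a homeomorphism of an open subset of `|M|` with an open subset of `ℝ^m`, together
with an isomorphism of the restricted structure sheaves. -/
structure SuperChart (M : SuperRingedSpace.{u}) (m n : ℕ) where
  toHomeo : OpenPartialHomeomorph M.carrier (E m)
  iso : ∀ W : Opens (E m), (W : Set (E m)) ⊆ toHomeo.target →
    Model m n W ≃ₐ[ℝ]
      M.sec ⟨toHomeo.source ∩ toHomeo ⁻¹' W, toHomeo.isOpen_inter_preimage W.isOpen⟩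
  iso_gr : ∀ (W : Opens (E m)) (hW : (W : Set (E m)) ⊆ toHomeo.target) (i : ZMod 2),
    ∀ f ∈ modelGr m n W i, iso W hW f ∈ M.gr _ i
  iso_res : ∀ (V W : Opens (E m)) (h : V ≤ W) (hW : (W : Set (E m)) ⊆ toHomeo.target)
    (f : Model m n W),
    iso V (Set.Subset.trans h hW) (modelRes n h f) =
      M.res (Set.inter_subset_inter_right _ (Set.preimage_mono h)) (iso W hW f)

/-- A supermanifold (`ℤ/2`-manifold) of dimension `m|n`: a locally `ℤ/2`-ringed space that is
locally isomorphic to `ℝ^{m|n}`. -/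
structure SuperManifold (m n : ℕ) extends SuperRingedSpace.{u} where
  exists_chart : ∀ p : carrier,
    ∃ c : SuperChart toSuperRingedSpace m n, p ∈ c.toHomeo.source

open SuperRingedSpace

/-! ### Riemannian metrics -/

/-- A Riemannian metric: a homogeneous, `ℤ/2`-symmetric, non-degenerate, linear morphism of sheaves
`TM ⊗ TM → O_M`. -/
structure SuperMetric {m n : ℕ} (M : SuperManifold.{u} m n) where
  /-- the degree `|g|` -/
  deg : ZMod 2
  /-- the form `⟨X, Y⟩` on sections over `U` -/
  form : ∀ U : Opens M.carrier, M.tangent U →+ M.tangent U →+ M.sec U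
  form_deg : ∀ U (i j : ZMod 2) (X Y : M.tangent U), HasDeg i X → HasDeg j Y →
    form U X Y ∈ M.gr U (i + j + deg)
  form_symm : ∀ U (i j : ZMod 2) (X Y : M.tangent U), HasDeg i X → HasDeg j Y →
    form U X Y = sgn i j • form U Y X
  form_smul : ∀ U (f : M.sec U) (X Y : M.tangent U), form U (f • X) Y = f * form U X Y
  form_res : ∀ {U V : Opens M.carrier} (h : V ≤ U) (X Y : M.tangent U) (X' Y' : M.tangent V),
    M.IsRestriction h X X' → M.IsRestriction h Y Y' → form V X' Y' = M.res h (form U X Y)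
  /-- Non-degeneracy: the metric identifies the tangent sheaf with its dual, that is, over every
  open set each linear form on the vector fields is `⟨-, Y⟩` for exactly one `Y`. -/
  nondegenerate : ∀ U (α : M.tangent U →ₗ[M.sec U] M.sec U),
    ∃! Y : M.tangent U, ∀ X, form U X Y = α X

/-- The metric `⟨X, Y⟩_g = g(X, Y)` on global vector fields. -/
abbrev SuperMetric.inner {m n : ℕ} {M : SuperManifold.{u} m n} (g : SuperMetric M)
    (X Y : M.Vect) : M.Fn :=
  g.form ⊤ X Y

/-! ### Affine connections -/

/-- An affine connection on a supermanifold. -/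
@[ext]
structure AffineConnection {m n : ℕ} (M : SuperManifold.{u} m n) where
  /-- the bi-additive map `(X, Y) ↦ ∇_X Y` -/
  nabla : M.Vect →+ M.Vect →+ M.Vect
  nabla_deg : ∀ (i j : ZMod 2) (X Y : M.Vect), HasDeg i X → HasDeg j Y →
    HasDeg (i + j) (nabla X Y)
  smul_left : ∀ (f : M.Fn) (X Y : M.Vect), nabla (f • X) Y = f • nabla X Y
  leibniz : ∀ (i j : ZMod 2) (f : M.Fn) (X Y : M.Vect), HasDeg i X → M.FnDeg j f →
    nabla X (f • Y) = X.1 f • Y + sgn i j • f • nabla X Y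

namespace AffineConnection

variable {m n : ℕ} {M : SuperManifold.{u} m n}

/-- The torsion `T(X, Y) = ∇_X Y - (-1)^{|X||Y|} ∇_Y X - [X, Y]` on homogeneous vector fields. -/
def torsion (D : AffineConnection M) {i j : ZMod 2} {X Y : M.Vect} (hX : HasDeg i X)
    (hY : HasDeg j Y) : M.Vect :=
  D.nabla X Y - sgn i j • D.nabla Y X - bracket hX hY

/-- `D` is symmetric: its torsion vanishes. -/
def IsSymmetric (D : AffineConnection M) : Prop :=
  ∀ (i j : ZMod 2) (X Y : M.Vect) (hX : HasDeg i X) (hY : HasDeg j Y), D.torsion hX hY = 0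

/-- `X⟨Y, Z⟩ = ⟨∇_X Y, Z⟩ + (-1)^{|X||Y|} ⟨Y, ∇_X Z⟩`. -/
def MetricCompatible (D : AffineConnection M) (g : SuperMetric M) : Prop :=
  ∀ (i j : ZMod 2) (X Y Z : M.Vect), HasDeg i X → HasDeg j Y →
    X.1 (g.inner Y Z) = g.inner (D.nabla X Y) Z + sgn i j • g.inner Y (D.nabla X Z)

/-- `D` is the Levi-Civita connection of `g`. -/
def IsLeviCivita (D : AffineConnection M) (g : SuperMetric M) : Prop :=
  D.IsSymmetric ∧ D.MetricCompatible g

end AffineConnection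

/-- The right multiplication `X · f = (-1)^{|X||f|} f X`, for `|X| = i` and `|f| = j`. -/
def rightMul {M : SuperRingedSpace.{u}} (i j : ZMod 2) (X : M.Vect) (f : M.Fn) : M.Vect :=
  sgn i j • f • X

namespace AffineConnection

variable {m n : ℕ} {M : SuperManifold.{u} m n}

/-- `D` is the semi-symmetric non-metric connection of `g` and `P`, that is,
`D_X Y = ∇^L_X Y + X · g(Y, P)` for homogeneous `X, Y`, where `∇^L` is the Levi-Civita connection.
As `|P| = |g|`, the function `g(Y, P)` has the degree of `Y`. -/
def IsSemiSymmetricNonMetric (D : AffineConnection M) (g : SuperMetric M) (P : M.Vect) : Prop :=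
  ∃ L : AffineConnection M, L.IsLeviCivita g ∧
    ∀ (i j : ZMod 2) (X Y : M.Vect), HasDeg i X → HasDeg j Y →
      D.nabla X Y = L.nabla X Y + rightMul i j X (g.inner Y P)

/-- The semi-symmetric torsion `T(X, Y) = X · g(Y, P) - (-1)^{|X||Y|} Y · g(X, P)`. -/
def HasSemiSymmetricTorsion (D : AffineConnection M) (g : SuperMetric M) (P : M.Vect) : Prop :=
  ∀ (i j : ZMod 2) (X Y : M.Vect) (hX : HasDeg i X) (hY : HasDeg j Y),
    D.torsion hX hY =
      rightMul i j X (g.inner Y P) - sgn i j • rightMul j i Y (g.inner X P)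

/-- The prescribed non-metricity
`⟨∇_X Y, Z⟩ + (-1)^{|X||Y|} ⟨Y, ∇_X Z⟩
  = X⟨Y, Z⟩ + (-1)^{|X||Y|} g(Y, P) g(X, Z) + (-1)^{|X||Y|} (-1)^{|Z|(|X|+|Y|)} g(Z, P) g(Y, X)`. -/
def HasNonMetricity (D : AffineConnection M) (g : SuperMetric M) (P : M.Vect) : Prop :=
  ∀ (i j k : ZMod 2) (X Y Z : M.Vect), HasDeg i X → HasDeg j Y → HasDeg k Z →
    g.inner (D.nabla X Y) Z + sgn i j • g.inner Y (D.nabla X Z) =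
      X.1 (g.inner Y Z) + sgn i j • (g.inner Y P * g.inner X Z) +
        (sgn i j * sgn k (i + j)) • (g.inner Z P * g.inner Y X)

end AffineConnection

end SuperGeometry

end

/-!
Both conditions on `D` become linear after subtracting the tensor `S(X, Y) = X · g(Y, P)`: the
torsion of `D` is the prescribed one if and only if `D - S` is torsion-free, and the non-metricity
of `D` is the prescribed one if and only if `D - S` is metric compatible. So the first two claims
reduce to the existence and uniqueness of the Levi-Civita connection. By non-degeneracy that is the
Koszul formula, whose right hand side is additive in all arguments and function-linear in the last
one.

If `D` were also metric compatible, non-degeneracy would give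
`g(Y, P) Z + (-1)^{|Y||Z|} g(Z, P) Y = 0` for all homogeneous `Y, Z`. Near a point with an even
coordinate `x`, take `Z = ∂/∂x` and evaluate at `x`: first `Y = Z` gives `g(Z, P) = 0`, and then
`g(Y, P) = 0` for every `Y`. With two odd coordinates `θ, η`, evaluating `Y = ∂/∂θ`, `Z = ∂/∂η` at
`η` gives `g(∂/∂θ, P) = 0`, and then evaluating `Y`, `Z = ∂/∂θ` at `θ` gives `g(Y, P) = 0` for every
`Y`. At an isolated point with at most one odd coordinate `θ`, every vector field is a multiple of
`Θ = ∂/∂θ`, and `⟨Θ, Θ⟩ = -⟨Θ, Θ⟩`, so that the metric itself vanishes there. Hence `P = 0`.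
Coordinate fields are extended to `M` by cutoff functions.
-/

noncomputable section

namespace SuperGeometry

open SuperRingedSpace

/-! ### Parities and homogeneous parts -/

lemma parity_cases (i : ZMod 2) : i = 0 ∨ i = 1 := by
  revert i; decide

lemma sgn_zero_left (i : ZMod 2) : sgn 0 i = 1 := by
  revert i; decide

lemma sgn_zero_right (i : ZMod 2) : sgn i 0 = 1 := by
  revert i; decide

lemma sgn_one_one : sgn 1 1 = -1 := by decide

lemma exists_add_eq_of_codisjoint {R A : Type*} [Semiring R] [AddCommMonoid A] [Module R A]
    {𝒜 : ZMod 2 → Submodule R A} (h : Codisjoint (𝒜 0) (𝒜 1)) (i : ZMod 2) (a : A) :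
    ∃ b ∈ 𝒜 i, ∃ c ∈ 𝒜 (i + 1), b + c = a := by
  obtain ⟨b, c, hb, hc, rfl⟩ := Submodule.codisjoint_iff_exists_add_eq.1 h a
  rcases parity_cases i with rfl | rfl
  · exact ⟨b, hb, c, hc, rfl⟩
  · exact ⟨c, hc, b, hb, add_comm c b⟩

section HomogeneousParts

variable {A : Type u} [Ring A] [Algebra ℝ A] {𝒜 : ZMod 2 → Submodule ℝ A} [SuperCommAlg 𝒜]

variable (𝒜) in
lemma exists_add_eq (i : ZMod 2) (a : A) : ∃ b ∈ 𝒜 i, ∃ c ∈ 𝒜 (i + 1), b + c = a := by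
  refine exists_add_eq_of_codisjoint (Submodule.codisjoint_iff_exists_add_eq.2 fun a => ?_) i a
  obtain ⟨a₀, h₀, a₁, h₁, rfl⟩ := exists_add_of_internal (𝒜 := 𝒜) a
  exact ⟨a₀, a₁, h₀, h₁, rfl⟩

lemma eq_zero_of_mem_of_mem {i j : ZMod 2} (hij : i ≠ j) {a : A} (hi : a ∈ 𝒜 i) (hj : a ∈ 𝒜 j) :
    a = 0 :=
  Submodule.disjoint_def.1
    ((SuperCommAlg.isInternal (𝒜 := 𝒜)).submodule_iSupIndep.pairwiseDisjoint hij) a hi hj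

lemma eq_zero_of_add_mem {i : ZMod 2} {a b : A} (ha : a ∈ 𝒜 i) (hb : b ∈ 𝒜 (i + 1))
    (h : a + b ∈ 𝒜 i) : b = 0 :=
  eq_zero_of_mem_of_mem (by simp) hb ((Submodule.add_mem_iff_right _ ha).1 h)

lemma derDeg_eq_zero_of_mem_of_mem {i j : ZMod 2} (hij : i ≠ j) {D : A →ₗ[ℝ] A}
    (hi : D ∈ derDeg 𝒜 i) (hj : D ∈ derDeg 𝒜 j) : D = 0 := by
  have hD : ∀ k, ∀ a ∈ 𝒜 k, D a = 0 := fun k a ha =>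
    eq_zero_of_mem_of_mem (by simpa using hij) (hi.1 k a ha) (hj.1 k a ha)
  ext a
  obtain ⟨a₀, h₀, a₁, h₁, rfl⟩ := exists_add_of_internal (𝒜 := 𝒜) a
  rw [map_add, hD _ _ h₀, hD _ _ h₁, add_zero, LinearMap.zero_apply]

variable (𝒜) in
/-- The homogeneous superderivations of degree `i`, as a real subspace of all superderivations. -/
def homDer (i : ZMod 2) : Submodule ℝ (der 𝒜) :=
  (derDeg 𝒜 i).comap ((der 𝒜).subtype.restrictScalars ℝ)

lemma isCompl_homDer (i : ZMod 2) : IsCompl (homDer 𝒜 i) (homDer 𝒜 (i + 1)) := by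
  have h : IsCompl (homDer 𝒜 0) (homDer 𝒜 1) := by
    refine IsCompl.of_eq ?_ ?_
    · refine (Submodule.eq_bot_iff _).2 fun X hX => Subtype.ext ?_
      exact derDeg_eq_zero_of_mem_of_mem zero_ne_one hX.1 hX.2
    · refine Submodule.eq_top_iff'.2 ?_
      rintro ⟨_, D₀, h₀, D₁, h₁, rfl⟩
      exact Submodule.mem_sup.2 ⟨⟨D₀, derDeg_le_der h₀⟩, h₀, ⟨D₁, derDeg_le_der h₁⟩, h₁, rfl⟩
  rcases parity_cases i with rfl | rfl
  · exact h
  · exact h.symm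

/-- The projection of superderivations onto their homogeneous part of degree `i`. -/
def homPart (i : ZMod 2) : der 𝒜 →ₗ[ℝ] der 𝒜 :=
  Submodule.projection (R := ℝ) (E := der 𝒜) _ _ (isCompl_homDer i)

lemma homPart_mem (i : ZMod 2) (X : der 𝒜) : (homPart i X).1 ∈ derDeg 𝒜 i :=
  Submodule.projection_apply_mem (isCompl_homDer i) X

lemma homPart_zero_add_homPart_one (X : der 𝒜) : homPart 0 X + homPart 1 X = X :=
  Submodule.projection_add_projection_eq_self (isCompl_homDer 0) X

lemma homPart_of_mem {i : ZMod 2} {X : der 𝒜} (hX : X.1 ∈ derDeg 𝒜 i) : homPart i X = X :=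
  Submodule.projection_apply_of_mem_left (isCompl_homDer i) (x := X) hX

lemma homPart_of_mem_of_ne {i j : ZMod 2} {X : der 𝒜} (hX : X.1 ∈ derDeg 𝒜 i) (hij : j ≠ i) :
    homPart j X = 0 :=
  (Submodule.projection_apply_eq_zero_iff (isCompl_homDer j)).2 <| by
    have hji : j + 1 = i := by
      clear hX
      decide +revert
    exact hji.symm ▸ hX

lemma sum_homPart_of_mem {C : Type*} [AddCommMonoid C] {F : ZMod 2 → der 𝒜 → C}
    (hF : ∀ i, F i 0 = 0) {i : ZMod 2} {X : der 𝒜} (hX : X.1 ∈ derDeg 𝒜 i) :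
    ∑ j, F j (homPart j X) = F i X := by
  rw [Finset.sum_eq_single i, homPart_of_mem hX]
  · intro j _ hj
    rw [homPart_of_mem_of_ne hX hj, hF]
  · simp

@[elab_as_elim]
lemma der_induction {p : der 𝒜 → Prop} (X : der 𝒜)
    (homogeneous : ∀ i X, X.1 ∈ derDeg 𝒜 i → p X) (add : ∀ X Y, p X → p Y → p (X + Y)) : p X :=
  homPart_zero_add_homPart_one X ▸
    add _ _ (homogeneous 0 _ (homPart_mem 0 X)) (homogeneous 1 _ (homPart_mem 1 X))

variable (𝒜) in
@[elab_as_elim]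
lemma homogeneous_induction {p : A → Prop} (f : A) (homogeneous : ∀ i, ∀ f ∈ 𝒜 i, p f)
    (add : ∀ f h, p f → p h → p (f + h)) : p f := by
  obtain ⟨f₀, h₀, f₁, h₁, rfl⟩ := exists_add_of_internal (𝒜 := 𝒜) f
  exact add _ _ (homogeneous 0 f₀ h₀) (homogeneous 1 f₁ h₁)

lemma smul_mem_derDeg' {i l : ZMod 2} {f : A} (hf : f ∈ 𝒜 l) {X : der 𝒜}
    (hX : X.1 ∈ derDeg 𝒜 i) : (f • X).1 ∈ derDeg 𝒜 (l + i) :=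
  smul_mem_derDeg hf hX

lemma der_smul_apply (f : A) (X : der 𝒜) (a : A) : (f • X).1 a = f * X.1 a := rfl

end HomogeneousParts

section SuperBracket

variable {A : Type u} [Ring A] [Algebra ℝ A] {𝒜 : ZMod 2 → Submodule ℝ A} [SuperCommAlg 𝒜]

/-- The bi-additive extension to all superderivations of the bracket
`[X, Y] = X ∘ Y - (-1)^{|X||Y|} Y ∘ X` of homogeneous ones. -/
def superBracket : der 𝒜 →+ der 𝒜 →+ der 𝒜 :=
  AddMonoidHom.mk' (fun X => AddMonoidHom.mk'
    (fun Y => ⟨∑ i, ∑ j, ((homPart i X).1 ∘ₗ (homPart j Y).1 -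
        sgn i j • ((homPart j Y).1 ∘ₗ (homPart i X).1)),
      sum_mem fun i _ => sum_mem fun j _ =>
        derDeg_le_der (bracket_mem_derDeg (homPart_mem i X) (homPart_mem j Y))⟩)
    fun Y Y' => Subtype.ext <| by
      simp only [map_add, Submodule.coe_add, LinearMap.comp_add, LinearMap.add_comp, smul_add,
        add_sub_add_comm, Finset.sum_add_distrib])
    fun X X' => AddMonoidHom.ext fun Y => Subtype.ext <| by
      simp only [AddMonoidHom.mk'_apply, AddMonoidHom.add_apply, map_add, Submodule.coe_add,
        LinearMap.comp_add, LinearMap.add_comp, smul_add, add_sub_add_comm,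
        Finset.sum_add_distrib]

lemma superBracket_eq {i j : ZMod 2} {X Y : der 𝒜} (hX : X.1 ∈ derDeg 𝒜 i)
    (hY : Y.1 ∈ derDeg 𝒜 j) :
    superBracket X Y =
      ⟨X.1 ∘ₗ Y.1 - sgn i j • (Y.1 ∘ₗ X.1), derDeg_le_der (bracket_mem_derDeg hX hY)⟩ := by
  refine Subtype.ext ?_
  let B (i j : ZMod 2) (X Y : der 𝒜) : A →ₗ[ℝ] A := X.1 ∘ₗ Y.1 - sgn i j • (Y.1 ∘ₗ X.1)
  calc ∑ i, ∑ j, B i j (homPart i X) (homPart j Y)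
      = ∑ j, B i j X (homPart j Y) :=
        sum_homPart_of_mem (F := fun i X => ∑ j, B i j X (homPart j Y)) (by simp [B]) hX
    _ = B i j X Y := sum_homPart_of_mem (F := fun j Y => B i j X Y) (by simp [B]) hY

lemma superBracket_mem {i j : ZMod 2} {X Y : der 𝒜} (hX : X.1 ∈ derDeg 𝒜 i)
    (hY : Y.1 ∈ derDeg 𝒜 j) : (superBracket X Y).1 ∈ derDeg 𝒜 (i + j) := by
  rw [superBracket_eq hX hY]
  exact bracket_mem_derDeg hX hY

lemma superBracket_apply {i j : ZMod 2} {X Y : der 𝒜} (hX : X.1 ∈ derDeg 𝒜 i)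
    (hY : Y.1 ∈ derDeg 𝒜 j) (a : A) :
    (superBracket X Y).1 a = X.1 (Y.1 a) - sgn i j • Y.1 (X.1 a) := by
  rw [superBracket_eq hX hY]; rfl

end SuperBracket

section SuperBracketRules

variable {A : Type u} [Ring A] [Algebra ℝ A] {𝒜 : ZMod 2 → Submodule ℝ A} [SuperCommAlg 𝒜]
  {i j l : ZMod 2} {f : A} {X Y : der 𝒜}

lemma superBracket_swap (hX : X.1 ∈ derDeg 𝒜 i) (hY : Y.1 ∈ derDeg 𝒜 j) :
    superBracket Y X = -sgn i j • superBracket X Y := by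
  ext a
  change (superBracket Y X).1 a = -sgn i j • (superBracket X Y).1 a
  rw [superBracket_apply hX hY, superBracket_apply hY hX, sgn_comm j i, neg_smul, smul_sub,
    smul_smul, sgn_mul_self, one_smul, neg_sub]

lemma superBracket_smul_right (hf : f ∈ 𝒜 l) (hX : X.1 ∈ derDeg 𝒜 i) (hY : Y.1 ∈ derDeg 𝒜 j) :
    superBracket X (f • Y) = X.1 f • Y + sgn i l • f • superBracket X Y := by
  ext a
  change (superBracket X (f • Y)).1 a = X.1 f * Y.1 a + sgn i l • (f * (superBracket X Y).1 a)
  rw [superBracket_apply hX (smul_mem_derDeg' hf hY), superBracket_apply hX hY, der_smul_apply,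
    der_smul_apply, hX.2 l f hf, sgn_add_right, mul_sub, smul_sub, mul_smul_comm, smul_smul]
  abel

end SuperBracketRules

/-! ### Metrics on the module of superderivations -/

section Metric

variable {A : Type u} [Ring A] [Algebra ℝ A] (𝒜 : ZMod 2 → Submodule ℝ A) [SuperCommAlg 𝒜]

/-- A homogeneous, graded symmetric, non-degenerate bilinear form of degree `d` on
superderivations: the metric over a single open set. -/
structure IsSuperMetric (d : ZMod 2) (g : der 𝒜 →+ der 𝒜 →+ A) : Prop where
  deg : ∀ (i j : ZMod 2) (X Y : der 𝒜), X.1 ∈ derDeg 𝒜 i → Y.1 ∈ derDeg 𝒜 j →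
    g X Y ∈ 𝒜 (i + j + d)
  symm : ∀ (i j : ZMod 2) (X Y : der 𝒜), X.1 ∈ derDeg 𝒜 i → Y.1 ∈ derDeg 𝒜 j →
    g X Y = sgn i j • g Y X
  smul : ∀ (f : A) (X Y : der 𝒜), g (f • X) Y = f * g X Y
  nondegenerate : ∀ α : der 𝒜 →ₗ[A] A, ∃! Y : der 𝒜, ∀ X, g X Y = α X

variable {𝒜} {d : ZMod 2} {g : der 𝒜 →+ der 𝒜 →+ A}

namespace IsSuperMetric

lemma smul_right (hg : IsSuperMetric 𝒜 d g) {i l : ZMod 2} {f : A} (hf : f ∈ 𝒜 l) {X : der 𝒜}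
    (hX : X.1 ∈ derDeg 𝒜 i) (Y : der 𝒜) : g X (f • Y) = sgn i l • (f * g X Y) := by
  induction Y using der_induction with
  | homogeneous j Y hY =>
    rw [hg.symm _ _ _ _ hX (smul_mem_derDeg' hf hY), hg.smul, hg.symm _ _ _ _ hX hY,
      sgn_add_right, mul_smul_comm, smul_smul]
  | add Y Y' h h' => rw [smul_add, map_add, map_add, h, h', mul_add, smul_add]

lemma ext_right (hg : IsSuperMetric 𝒜 d g) {W W' : der 𝒜}
    (h : ∀ i Z, Z.1 ∈ derDeg 𝒜 i → g Z W = g Z W') : W = W' := by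
  have h' (Z : der 𝒜) : g Z W = g Z W' := by
    induction Z using der_induction with
    | homogeneous i Z hZ => exact h i Z hZ
    | add Z Z' hZ hZ' => simp only [map_add, AddMonoidHom.add_apply, hZ, hZ']
  let α : der 𝒜 →ₗ[A] A :=
    { toFun := fun Z => g Z W
      map_add' := fun Z Z' => by simp
      map_smul' := fun f Z => hg.smul f Z W }
  exact (hg.nondegenerate α).unique (fun _ => rfl) (fun Z => (h' Z).symm)

lemma ext_left (hg : IsSuperMetric 𝒜 d g) {i : ZMod 2} {W W' : der 𝒜}
    (hW : W.1 ∈ derDeg 𝒜 i) (hW' : W'.1 ∈ derDeg 𝒜 i)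
    (h : ∀ k Z, Z.1 ∈ derDeg 𝒜 k → g W Z = g W' Z) : W = W' :=
  hg.ext_right fun k Z hZ => by
    rw [hg.symm _ _ _ _ hZ hW, hg.symm _ _ _ _ hZ hW', h k Z hZ]

lemma mem_derDeg (hg : IsSuperMetric 𝒜 d g) {e : ZMod 2} {W : der 𝒜}
    (h : ∀ k Z, Z.1 ∈ derDeg 𝒜 k → g Z W ∈ 𝒜 (k + e + d)) : W.1 ∈ derDeg 𝒜 e := by
  have hW : W = homPart e W + homPart (e + 1) W := by
    rcases parity_cases e with rfl | rfl
    · exact (homPart_zero_add_homPart_one W).symm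
    · exact ((add_comm _ _).trans (homPart_zero_add_homPart_one W)).symm
  have h0 : homPart (e + 1) W = 0 := hg.ext_right fun k Z hZ => by
    have h1 : g Z (homPart (e + 1) W) ∈ 𝒜 (k + e + d) := by
      have h2 := h k Z hZ
      rw [hW, map_add] at h2
      exact (add_mem_cancel_left (hg.deg _ _ _ _ hZ (homPart_mem e W))).1 h2
    rw [map_zero]
    exact eq_zero_of_mem_of_mem (by simp) h1 (hg.deg _ _ _ _ hZ (homPart_mem (e + 1) W))
  rw [h0, add_zero] at hW
  exact hW ▸ homPart_mem e W

end IsSuperMetric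

lemma form_zsmul_left (c : ℤ) (X Y : der 𝒜) : g (c • X) Y = c • g X Y :=
  DFunLike.congr_fun (map_zsmul g c X) Y

/-! ### The Koszul formula -/

section Koszul

variable (g) in
/-- The right hand side of the Koszul formula for `2⟨∇_X Y, Z⟩`. -/
def koszul (i j k : ZMod 2) (X Y Z : der 𝒜) : A :=
  X.1 (g Y Z) + sgn i j • Y.1 (g X Z) - sgn k (i + j) • Z.1 (g X Y)
    + g (superBracket X Y) Z - sgn j k • g (superBracket X Z) Y
    - sgn i (j + k) • g (superBracket Y Z) X

variable {i j k l : ZMod 2} {f : A} {X Y Z : der 𝒜}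

lemma koszul_smul_third (hg : IsSuperMetric 𝒜 d g) (hf : f ∈ 𝒜 l) (hX : X.1 ∈ derDeg 𝒜 i)
    (hY : Y.1 ∈ derDeg 𝒜 j) (hZ : Z.1 ∈ derDeg 𝒜 k) :
    koszul g i j (l + k) X Y (f • Z) = sgn l (i + j) • (f * koszul g i j k X Y Z) := by
  unfold koszul
  rw [hg.smul_right hf hX, hg.smul_right hf hY, hg.smul_right hf (superBracket_mem hX hY),
    superBracket_smul_right hf hX hZ, superBracket_smul_right hf hY hZ]
  simp only [map_add, map_zsmul, AddMonoidHom.add_apply, form_zsmul_left, hg.smul, der_smul_apply,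
    hX.2 l f hf, hY.2 l f hf, hg.symm _ _ _ _ hZ hX, hg.symm _ _ _ _ hZ hY,
    mul_add, mul_sub, mul_smul_comm, smul_add, smul_smul]
  match_scalars <;> (clear * -; norm_cast; revert i j k l; decide)

lemma koszul_torsion (hg : IsSuperMetric 𝒜 d g) (hX : X.1 ∈ derDeg 𝒜 i)
    (hY : Y.1 ∈ derDeg 𝒜 j) :
    koszul g i j k X Y Z - sgn i j • koszul g j i k Y X Z =
      (2 : ℤ) • g (superBracket X Y) Z := by
  unfold koszul
  rw [superBracket_swap hX hY, hg.symm _ _ _ _ hY hX]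
  simp only [map_zsmul, form_zsmul_left, smul_add, smul_sub, smul_smul]
  match_scalars <;> (clear * -; norm_cast; revert i j k; decide)

lemma koszul_metric (hg : IsSuperMetric 𝒜 d g) (hY : Y.1 ∈ derDeg 𝒜 j) (hZ : Z.1 ∈ derDeg 𝒜 k) :
    koszul g i j k X Y Z + sgn j k • koszul g i k j X Z Y = (2 : ℤ) • X.1 (g Y Z) := by
  unfold koszul
  rw [superBracket_swap hY hZ, hg.symm _ _ _ _ hZ hY]
  simp only [map_zsmul, form_zsmul_left, smul_add, smul_sub, smul_smul]
  match_scalars <;> (clear * -; norm_cast; revert i j k; decide)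

lemma koszul_mem (hg : IsSuperMetric 𝒜 d g) (hX : X.1 ∈ derDeg 𝒜 i) (hY : Y.1 ∈ derDeg 𝒜 j)
    (hZ : Z.1 ∈ derDeg 𝒜 k) : koszul g i j k X Y Z ∈ 𝒜 (i + j + k + d) := by
  have hXYZ : X.1 (g Y Z) ∈ 𝒜 (i + j + k + d) := by
    simpa only [add_assoc] using hX.1 _ _ (hg.deg _ _ _ _ hY hZ)
  have hYXZ : Y.1 (g X Z) ∈ 𝒜 (i + j + k + d) := by
    simpa only [add_assoc, add_left_comm] using hY.1 _ _ (hg.deg _ _ _ _ hX hZ)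
  have hZXY : Z.1 (g X Y) ∈ 𝒜 (i + j + k + d) := by
    simpa only [add_assoc, add_left_comm] using hZ.1 _ _ (hg.deg _ _ _ _ hX hY)
  have hXY : g (superBracket X Y) Z ∈ 𝒜 (i + j + k + d) :=
    hg.deg _ _ _ _ (superBracket_mem hX hY) hZ
  have hXZ : g (superBracket X Z) Y ∈ 𝒜 (i + j + k + d) := by
    simpa only [add_right_comm] using hg.deg _ _ _ _ (superBracket_mem hX hZ) hY
  have hYZ : g (superBracket Y Z) X ∈ 𝒜 (i + j + k + d) := by
    simpa only [add_assoc, add_left_comm] using hg.deg _ _ _ _ (superBracket_mem hY hZ) hX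
  exact sub_mem (sub_mem (add_mem (sub_mem (add_mem hXYZ (zsmul_mem hYXZ _)) (zsmul_mem hZXY _))
    hXY) (zsmul_mem hXZ _)) (zsmul_mem hYZ _)

variable (g) in
/-- The Koszul expression for `2⟨Z, ∇_X Y⟩`, for arbitrary superderivations. -/
def koszulTotal (X Y Z : der 𝒜) : A :=
  ∑ i, ∑ j, ∑ k, sgn k (i + j) • koszul g i j k (homPart i X) (homPart j Y) (homPart k Z)

lemma koszulTotal_of_mem (hX : X.1 ∈ derDeg 𝒜 i) (hY : Y.1 ∈ derDeg 𝒜 j)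
    (hZ : Z.1 ∈ derDeg 𝒜 k) : koszulTotal g X Y Z = sgn k (i + j) • koszul g i j k X Y Z := by
  let K (i j k : ZMod 2) (X Y Z : der 𝒜) : A := sgn k (i + j) • koszul g i j k X Y Z
  calc koszulTotal g X Y Z
      = ∑ j, ∑ k, K i j k X (homPart j Y) (homPart k Z) :=
        sum_homPart_of_mem (F := fun i X => ∑ j, ∑ k, K i j k X (homPart j Y) (homPart k Z))
          (by simp [K, koszul]) hX
    _ = ∑ k, K i j k X Y (homPart k Z) :=
        sum_homPart_of_mem (F := fun j Y => ∑ k, K i j k X Y (homPart k Z))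
          (by simp [K, koszul]) hY
    _ = K i j k X Y Z :=
        sum_homPart_of_mem (F := fun k Z => K i j k X Y Z) (by simp [K, koszul]) hZ

lemma koszulTotal_add_first (X X' Y Z : der 𝒜) :
    koszulTotal g (X + X') Y Z = koszulTotal g X Y Z + koszulTotal g X' Y Z := by
  simp only [koszulTotal, ← Finset.sum_add_distrib, ← smul_add]
  congr! 7
  simp only [koszul, map_add, AddMonoidHom.add_apply, Submodule.coe_add, LinearMap.add_apply,
    smul_add]
  abel

lemma koszulTotal_add_second (X Y Y' Z : der 𝒜) :
    koszulTotal g X (Y + Y') Z = koszulTotal g X Y Z + koszulTotal g X Y' Z := by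
  simp only [koszulTotal, ← Finset.sum_add_distrib, ← smul_add]
  congr! 7
  simp only [koszul, map_add, AddMonoidHom.add_apply, Submodule.coe_add, LinearMap.add_apply,
    smul_add]
  abel

lemma koszulTotal_add_third (X Y Z Z' : der 𝒜) :
    koszulTotal g X Y (Z + Z') = koszulTotal g X Y Z + koszulTotal g X Y Z' := by
  simp only [koszulTotal, ← Finset.sum_add_distrib, ← smul_add]
  congr! 7
  simp only [koszul, map_add, AddMonoidHom.add_apply, Submodule.coe_add, LinearMap.add_apply,
    smul_add]
  abel

lemma koszulTotal_smul_third (hg : IsSuperMetric 𝒜 d g) (f : A) (X Y Z : der 𝒜) :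
    koszulTotal g X Y (f • Z) = f * koszulTotal g X Y Z := by
  induction X using der_induction with
  | add X X' h h' => simp only [koszulTotal_add_first, h, h', mul_add]
  | homogeneous i X hX =>
  induction Y using der_induction with
  | add Y Y' h h' => simp only [koszulTotal_add_second, h, h', mul_add]
  | homogeneous j Y hY =>
  induction Z using der_induction with
  | add Z Z' h h' => simp only [smul_add, koszulTotal_add_third, h, h', mul_add]
  | homogeneous k Z hZ =>
  induction f using homogeneous_induction 𝒜 with
  | add f f' h h' => simp only [add_smul, koszulTotal_add_third, h, h', add_mul]
  | homogeneous l f hf =>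
    rw [koszulTotal_of_mem hX hY (smul_mem_derDeg' hf hZ), koszulTotal_of_mem hX hY hZ,
      koszul_smul_third hg hf hX hY hZ, smul_smul, mul_smul_comm, sgn_add_left, mul_right_comm,
      sgn_mul_self, one_mul]

end Koszul

end Metric

/-! ### The Levi-Civita connection -/

section LeviCivita

variable {A : Type u} [Ring A] [Algebra ℝ A] {𝒜 : ZMod 2 → Submodule ℝ A} [SuperCommAlg 𝒜]
  {d : ZMod 2} {g : der 𝒜 →+ der 𝒜 →+ A} {i j k l : ZMod 2} {f : A} {X Y Z : der 𝒜}

/-- The bi-additive map `(X, Y) ↦ N X Y` has the degree, the torsion and the metric compatibility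
of the Levi-Civita connection of `g`; the linearity rules of a connection then follow. -/
structure IsLeviCivitaMap (g : der 𝒜 →+ der 𝒜 →+ A) (N : der 𝒜 →+ der 𝒜 →+ der 𝒜) : Prop where
  deg : ∀ (i j : ZMod 2) (X Y : der 𝒜), X.1 ∈ derDeg 𝒜 i → Y.1 ∈ derDeg 𝒜 j →
    (N X Y).1 ∈ derDeg 𝒜 (i + j)
  torsion : ∀ (i j : ZMod 2) (X Y : der 𝒜), X.1 ∈ derDeg 𝒜 i → Y.1 ∈ derDeg 𝒜 j →
    N X Y = sgn i j • N Y X + superBracket X Y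
  metric : ∀ (i j : ZMod 2) (X Y Z : der 𝒜), X.1 ∈ derDeg 𝒜 i → Y.1 ∈ derDeg 𝒜 j →
    X.1 (g Y Z) = g (N X Y) Z + sgn i j • g Y (N X Z)

lemma two_zsmul_cancel {a b : A} (h : (2 : ℤ) • a = (2 : ℤ) • b) : a = b :=
  smul_right_injective A (two_ne_zero (α := ℝ)) (by simpa only [two_smul] using h)

namespace IsLeviCivitaMap

variable {N N' : der 𝒜 →+ der 𝒜 →+ der 𝒜}

lemma leibniz (hg : IsSuperMetric 𝒜 d g) (hN : IsLeviCivitaMap g N) (hX : X.1 ∈ derDeg 𝒜 i)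
    (hf : f ∈ 𝒜 l) (Y : der 𝒜) : N X (f • Y) = X.1 f • Y + sgn i l • f • N X Y := by
  induction Y using der_induction with
  | add Y Y' h h' => rw [smul_add, map_add, map_add, h, h', smul_add, smul_add, smul_add]; abel
  | homogeneous j Y hY =>
  have hfY := smul_mem_derDeg' hf hY
  refine hg.ext_left (hN.deg _ _ _ _ hX hfY) (add_mem ?_ (zsmul_mem ?_ _)) fun k Z _ => ?_
  · exact add_assoc i l j ▸ smul_mem_derDeg' (hX.1 _ _ hf) hY
  · exact add_left_comm l i j ▸ smul_mem_derDeg' hf (hN.deg _ _ _ _ hX hY)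
  have hfYZ := hN.metric _ _ _ _ Z hX hfY
  rw [hg.smul, hg.smul, hX.2 l f hf, hN.metric _ _ _ _ Z hX hY] at hfYZ
  rw [map_add, AddMonoidHom.add_apply, form_zsmul_left, hg.smul, hg.smul]
  refine add_right_cancel (hfYZ.symm.trans ?_)
  rw [mul_add, mul_smul_comm, smul_add, smul_smul, ← sgn_add_right, add_assoc]

lemma smul_left (hg : IsSuperMetric 𝒜 d g) (hN : IsLeviCivitaMap g N) (f : A) (X Y : der 𝒜) :
    N (f • X) Y = f • N X Y := by
  induction X using der_induction with
  | add X X' h h' => simp only [smul_add, map_add, AddMonoidHom.add_apply, h, h']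
  | homogeneous i X hX =>
  induction Y using der_induction with
  | add Y Y' h h' => simp only [smul_add, map_add, h, h']
  | homogeneous j Y hY =>
  induction f using homogeneous_induction 𝒜 with
  | add f f' h h' => simp only [add_smul, map_add, AddMonoidHom.add_apply, h, h']
  | homogeneous l f hf =>
    have hfX := smul_mem_derDeg' hf hX
    rw [hN.torsion _ _ _ _ hfX hY, superBracket_swap hY hfX, hN.leibniz hg hY hf,
      superBracket_smul_right hf hY hX, hN.torsion _ _ _ _ hX hY, superBracket_swap hY hX]
    rw [smul_add f, smul_comm f (sgn i j), smul_comm f (-sgn j i)]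
    generalize Y.1 f • X = U, f • N Y X = V, f • superBracket Y X = W
    match_scalars <;> (clear * -; norm_cast; revert i j l; decide)

lemma two_zsmul_form (hg : IsSuperMetric 𝒜 d g) (hN : IsLeviCivitaMap g N)
    (hX : X.1 ∈ derDeg 𝒜 i) (hY : Y.1 ∈ derDeg 𝒜 j) (hZ : Z.1 ∈ derDeg 𝒜 k) :
    (2 : ℤ) • g (N X Y) Z = koszul g i j k X Y Z := by
  have bracket {i j : ZMod 2} {X Y : der 𝒜} (hX : X.1 ∈ derDeg 𝒜 i) (hY : Y.1 ∈ derDeg 𝒜 j)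
      (Z : der 𝒜) : g (superBracket X Y) Z = g (N X Y) Z - sgn i j • g (N Y X) Z := by
    rw [hN.torsion _ _ _ _ hX hY, map_add, AddMonoidHom.add_apply, form_zsmul_left,
      add_sub_cancel_left]
  have metric {i j k : ZMod 2} {X Y Z : der 𝒜} (hX : X.1 ∈ derDeg 𝒜 i) (hY : Y.1 ∈ derDeg 𝒜 j)
      (hZ : Z.1 ∈ derDeg 𝒜 k) :
      X.1 (g Y Z) = g (N X Y) Z + sgn j k • g (N X Z) Y := by
    rw [hN.metric _ _ _ _ Z hX hY, hg.symm _ _ _ _ hY (hN.deg _ _ _ _ hX hZ), smul_smul,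
      sgn_add_right, ← mul_assoc, sgn_comm j i, sgn_mul_self, one_mul]
  rw [koszul, bracket hX hY, bracket hX hZ, bracket hY hZ, metric hX hY hZ, metric hY hX hZ,
    metric hZ hX hY]
  match_scalars <;> (clear * -; revert i j k; decide)

lemma unique (hg : IsSuperMetric 𝒜 d g) (hN : IsLeviCivitaMap g N) (hN' : IsLeviCivitaMap g N') :
    N = N' := by
  ext1 X
  induction X using der_induction with
  | add X X' h h' => rw [map_add, map_add, h, h']
  | homogeneous i X hX =>
  ext1 Y
  induction Y using der_induction with
  | add Y Y' h h' => rw [map_add, map_add, h, h']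
  | homogeneous j Y hY =>
    refine hg.ext_left (hN.deg _ _ _ _ hX hY) (hN'.deg _ _ _ _ hX hY) fun k Z hZ => ?_
    apply two_zsmul_cancel
    rw [hN.two_zsmul_form hg hX hY hZ, hN'.two_zsmul_form hg hX hY hZ]

end IsLeviCivitaMap

lemma exists_form_eq_koszulTotal (hg : IsSuperMetric 𝒜 d g) :
    ∃ N : der 𝒜 →+ der 𝒜 →+ der 𝒜, ∀ X Y Z, (2 : ℤ) • g Z (N X Y) = koszulTotal g X Y Z := by
  let α (X Y : der 𝒜) : der 𝒜 →ₗ[A] A :=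
    { toFun := fun Z => (2⁻¹ : ℝ) • koszulTotal g X Y Z
      map_add' := fun Z Z' => by rw [koszulTotal_add_third, smul_add]
      map_smul' := fun f Z => by
        rw [koszulTotal_smul_third hg, RingHom.id_apply, smul_eq_mul, mul_smul_comm] }
  choose N hN using fun X Y => (hg.nondegenerate (α X Y)).exists
  replace hN (X Y Z : der 𝒜) : g Z (N X Y) = (2⁻¹ : ℝ) • koszulTotal g X Y Z := hN X Y Z
  have add_right (X Y Y' : der 𝒜) : N X (Y + Y') = N X Y + N X Y' :=
    hg.ext_right fun _ Z _ => by rw [map_add, hN, hN, hN, koszulTotal_add_second, smul_add]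
  have add_left (X X' Y : der 𝒜) : N (X + X') Y = N X Y + N X' Y :=
    hg.ext_right fun _ Z _ => by rw [map_add, hN, hN, hN, koszulTotal_add_first, smul_add]
  refine ⟨AddMonoidHom.mk' (fun X => AddMonoidHom.mk' (N X) (add_right X))
    fun X X' => AddMonoidHom.ext (add_left X X'), fun X Y Z => ?_⟩
  change (2 : ℤ) • g Z (N X Y) = _
  rw [hN, two_smul, ← add_smul, ← two_mul, mul_inv_cancel₀ two_ne_zero, one_smul]

lemma exists_isLeviCivitaMap (hg : IsSuperMetric 𝒜 d g) : ∃ N, IsLeviCivitaMap g N := by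
  obtain ⟨N, hN⟩ := exists_form_eq_koszulTotal hg
  have deg (i j : ZMod 2) (X Y : der 𝒜) (hX : X.1 ∈ derDeg 𝒜 i) (hY : Y.1 ∈ derDeg 𝒜 j) :
      (N X Y).1 ∈ derDeg 𝒜 (i + j) := hg.mem_derDeg fun k Z hZ => by
    have h : (2 : ℝ) • g Z (N X Y) ∈ 𝒜 (i + j + k + d) := by
      rw [two_smul, ← two_zsmul, hN, koszulTotal_of_mem hX hY hZ]
      exact zsmul_mem (koszul_mem hg hX hY hZ) _
    rw [add_comm k]
    exact (Submodule.smul_mem_iff _ two_ne_zero).1 h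
  have koszul_eq {i j k : ZMod 2} {X Y Z : der 𝒜} (hX : X.1 ∈ derDeg 𝒜 i)
      (hY : Y.1 ∈ derDeg 𝒜 j) (hZ : Z.1 ∈ derDeg 𝒜 k) :
      (2 : ℤ) • g (N X Y) Z = koszul g i j k X Y Z := by
    rw [hg.symm _ _ _ _ (deg _ _ _ _ hX hY) hZ, smul_comm, hN, koszulTotal_of_mem hX hY hZ,
      smul_smul, sgn_comm, sgn_mul_self, one_smul]
  refine ⟨N, deg, fun i j X Y hX hY => ?_, fun i j X Y Z hX hY => ?_⟩
  · refine hg.ext_left (deg _ _ _ _ hX hY) (add_mem (zsmul_mem ?_ _) (superBracket_mem hX hY))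
      fun k Z hZ => two_zsmul_cancel ?_
    · exact add_comm j i ▸ deg _ _ _ _ hY hX
    · rw [map_add, AddMonoidHom.add_apply, form_zsmul_left, smul_add, smul_comm (2 : ℤ),
        koszul_eq hX hY hZ, koszul_eq hY hX hZ, ← koszul_torsion hg hX hY, add_sub_cancel]
  · induction Z using der_induction with
    | add Z Z' h h' => simp only [map_add, h, h', smul_add]; abel
    | homogeneous k Z hZ =>
    apply two_zsmul_cancel
    rw [hg.symm _ _ _ _ hY (deg _ _ _ _ hX hZ), smul_smul, sgn_add_right, ← mul_assoc,
      sgn_comm j i, sgn_mul_self, one_mul, smul_add, smul_comm (2 : ℤ), koszul_eq hX hY hZ,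
      koszul_eq hX hZ hY, koszul_metric hg hY hZ]

end LeviCivita

/-! ### Semi-symmetric non-metric connections -/

section Tensor

variable {A : Type u} [Ring A] [Algebra ℝ A] {𝒜 : ZMod 2 → Submodule ℝ A} [SuperCommAlg 𝒜]
  {d : ZMod 2} {g : der 𝒜 →+ der 𝒜 →+ A} {P : der 𝒜} {i j k : ZMod 2} {X Y Z : der 𝒜}

/-- `S` is a tensor of degree zero: a difference of two affine connections. -/
structure IsTensor (S : der 𝒜 →+ der 𝒜 →+ der 𝒜) : Prop where
  deg : ∀ (i j : ZMod 2) (X Y : der 𝒜), X.1 ∈ derDeg 𝒜 i → Y.1 ∈ derDeg 𝒜 j →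
    (S X Y).1 ∈ derDeg 𝒜 (i + j)
  smul_left : ∀ (f : A) (X Y : der 𝒜), S (f • X) Y = f • S X Y
  smul_right : ∀ (i l : ZMod 2) (f : A) (X Y : der 𝒜), X.1 ∈ derDeg 𝒜 i → f ∈ 𝒜 l →
    S X (f • Y) = sgn i l • f • S X Y

lemma IsTensor.neg {S : der 𝒜 →+ der 𝒜 →+ der 𝒜} (hS : IsTensor S) : IsTensor (-S) where
  deg i j X Y hX hY := neg_mem (hS.deg i j X Y hX hY)
  smul_left f X Y := by simp only [AddMonoidHom.neg_apply, hS.smul_left, smul_neg]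
  smul_right i l f X Y hX hf := by
    simp only [AddMonoidHom.neg_apply, hS.smul_right i l f X Y hX hf, smul_neg]

variable (g P) in
/-- The bi-additive extension to all superderivations of the map `(X, Y) ↦ X · g(Y, P)` on
homogeneous ones. -/
def twist : der 𝒜 →+ der 𝒜 →+ der 𝒜 :=
  AddMonoidHom.mk' (fun X => AddMonoidHom.mk'
    (fun Y => ∑ i, ∑ j, sgn i j • g (homPart j Y) P • homPart i X)
    fun Y Y' => by
      simp only [map_add, AddMonoidHom.add_apply, add_smul, smul_add, Finset.sum_add_distrib])
    fun X X' => AddMonoidHom.ext fun Y => by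
      simp only [AddMonoidHom.mk'_apply, AddMonoidHom.add_apply, map_add, smul_add,
        Finset.sum_add_distrib]

lemma twist_of_mem (hX : X.1 ∈ derDeg 𝒜 i) (hY : Y.1 ∈ derDeg 𝒜 j) :
    twist g P X Y = sgn i j • g Y P • X := by
  calc twist g P X Y = ∑ j, sgn i j • g (homPart j Y) P • X :=
        sum_homPart_of_mem (F := fun i X => ∑ j, sgn i j • g (homPart j Y) P • X) (by simp) hX
    _ = sgn i j • g Y P • X :=
        sum_homPart_of_mem (F := fun j Y => sgn i j • g Y P • X) (by simp) hY

lemma IsSuperMetric.apply_mem (hg : IsSuperMetric 𝒜 d g) (hP : P.1 ∈ derDeg 𝒜 d)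
    (hY : Y.1 ∈ derDeg 𝒜 j) : g Y P ∈ 𝒜 j := by
  have h : j + d + d = j := by rw [add_assoc, CharTwo.add_self_eq_zero, add_zero]
  exact h ▸ hg.deg j d Y P hY hP

lemma isTensor_twist (hg : IsSuperMetric 𝒜 d g) (hP : P.1 ∈ derDeg 𝒜 d) :
    IsTensor (twist g P) where
  deg i j X Y hX hY := by
    rw [twist_of_mem hX hY, add_comm]
    exact zsmul_mem (smul_mem_derDeg' (hg.apply_mem hP hY) hX) _
  smul_left f X Y := by
    induction X using der_induction with
    | add X X' h h' => simp only [smul_add, map_add, AddMonoidHom.add_apply, h, h']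
    | homogeneous i X hX =>
    induction Y using der_induction with
    | add Y Y' h h' => simp only [map_add, smul_add, h, h']
    | homogeneous j Y hY =>
    induction f using homogeneous_induction 𝒜 with
    | add f f' h h' => simp only [add_smul, map_add, AddMonoidHom.add_apply, h, h']
    | homogeneous l f hf =>
      rw [twist_of_mem (smul_mem_derDeg' hf hX) hY, twist_of_mem hX hY, smul_smul,
        SuperCommAlg.super_comm _ _ _ (hg.apply_mem hP hY) f hf, smul_comm f, smul_assoc, smul_smul,
        smul_smul, sgn_add_left, sgn_comm l, mul_right_comm, sgn_mul_self, one_mul]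
  smul_right i l f X Y hX hf := by
    induction Y using der_induction with
    | add Y Y' h h' => simp only [map_add, smul_add, h, h']
    | homogeneous j Y hY =>
      rw [twist_of_mem hX (smul_mem_derDeg' hf hY), twist_of_mem hX hY, hg.smul,
        sgn_add_right, mul_smul (sgn i l), mul_smul f, smul_comm f (sgn i j)]

lemma form_twist_add (hg : IsSuperMetric 𝒜 d g) (hP : P.1 ∈ derDeg 𝒜 d) (hX : X.1 ∈ derDeg 𝒜 i)
    (hY : Y.1 ∈ derDeg 𝒜 j) (hZ : Z.1 ∈ derDeg 𝒜 k) :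
    g (twist g P X Y) Z + sgn i j • g Y (twist g P X Z) =
      sgn i j • (g Y P * g X Z) + (sgn i j * sgn k (i + j)) • (g Z P * g Y X) := by
  rw [twist_of_mem hX hY, twist_of_mem hX hZ, form_zsmul_left, map_zsmul (g Y), hg.smul,
    hg.smul_right (hg.apply_mem hP hZ) hY, smul_smul, smul_smul, sgn_add_right, sgn_comm k i,
    sgn_comm k j, mul_assoc]

lemma nonMetricity_add_twist_iff (hg : IsSuperMetric 𝒜 d g) (hP : P.1 ∈ derDeg 𝒜 d)
    (N : der 𝒜 →+ der 𝒜 →+ der 𝒜) (hX : X.1 ∈ derDeg 𝒜 i) (hY : Y.1 ∈ derDeg 𝒜 j)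
    (hZ : Z.1 ∈ derDeg 𝒜 k) :
    g (N X Y + twist g P X Y) Z + sgn i j • g Y (N X Z + twist g P X Z) =
        X.1 (g Y Z) + sgn i j • (g Y P * g X Z) + (sgn i j * sgn k (i + j)) • (g Z P * g Y X) ↔
      X.1 (g Y Z) = g (N X Y) Z + sgn i j • g Y (N X Z) := by
  rw [add_assoc (X.1 _), ← form_twist_add hg hP hX hY hZ, map_add, map_add,
    AddMonoidHom.add_apply, smul_add, add_add_add_comm, add_left_inj, eq_comm]

lemma torsion_add_twist_iff (N : der 𝒜 →+ der 𝒜 →+ der 𝒜) (hX : X.1 ∈ derDeg 𝒜 i)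
    (hY : Y.1 ∈ derDeg 𝒜 j) (B : der 𝒜) :
    N X Y + twist g P X Y - sgn i j • (N Y X + twist g P Y X) - B =
        sgn i j • g Y P • X - sgn i j • sgn j i • g X P • Y ↔
      N X Y - sgn i j • N Y X - B = 0 := by
  rw [← twist_of_mem hX hY, ← twist_of_mem hY hX, smul_add, ← sub_eq_zero]
  exact Eq.congr_left (by abel)

end Tensor

section Connections

variable {m n : ℕ} {M : SuperManifold.{u} m n} {g : SuperMetric M} {P : M.Vect}

lemma SuperMetric.isSuperMetric (g : SuperMetric M) (U : Opens M.carrier) :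
    IsSuperMetric (M.gr U) g.deg (g.form U) :=
  ⟨g.form_deg U, g.form_symm U, g.form_smul U, g.nondegenerate U⟩

namespace AffineConnection

lemma isLeviCivita_iff {L : AffineConnection M} :
    L.IsLeviCivita g ↔ IsLeviCivitaMap (g.form ⊤) L.nabla := by
  have torsion_eq_zero {i j : ZMod 2} {X Y : M.Vect} (hX : HasDeg i X) (hY : HasDeg j Y) :
      L.torsion hX hY = 0 ↔ L.nabla X Y = sgn i j • L.nabla Y X + superBracket X Y := by
    rw [show superBracket X Y = bracket hX hY from superBracket_eq hX hY]
    exact sub_eq_zero.trans (sub_eq_iff_eq_add' (G := M.Vect))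
  exact ⟨fun h => ⟨L.nabla_deg, fun i j X Y hX hY => (torsion_eq_zero hX hY).1 (h.1 i j X Y hX hY),
    h.2⟩, fun h => ⟨fun i j X Y hX hY => (torsion_eq_zero hX hY).2 (h.torsion i j X Y hX hY),
    h.metric⟩⟩

lemma existsUnique_isLeviCivita (g : SuperMetric M) :
    ∃! L : AffineConnection M, L.IsLeviCivita g := by
  have hg := g.isSuperMetric ⊤
  obtain ⟨N, hN⟩ := exists_isLeviCivitaMap hg
  refine ⟨⟨N, hN.deg, hN.smul_left hg, fun i j f X Y hX hf => hN.leibniz hg hX hf Y⟩,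
    isLeviCivita_iff.2 hN, fun L hL => ?_⟩
  ext1
  exact (isLeviCivita_iff.1 hL).unique hg hN

/-- The affine connection `∇ + S`, for a tensor `S`. -/
def addTensor (D : AffineConnection M) {S : M.Vect →+ M.Vect →+ M.Vect} (hS : IsTensor S) :
    AffineConnection M where
  nabla := D.nabla + S
  nabla_deg i j X Y hX hY := add_mem (D.nabla_deg i j X Y hX hY) (hS.deg i j X Y hX hY)
  smul_left f X Y := by
    simp only [AddMonoidHom.add_apply, D.smul_left, hS.smul_left, smul_add]
  leibniz i l f X Y hX hf := by
    simp only [AddMonoidHom.add_apply, D.leibniz i l f X Y hX hf, hS.smul_right i l f X Y hX hf,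
      smul_add, add_assoc]

/-- The connection `∇ + S` for the tensor `S(X, Y) = X · g(Y, P)`. -/
def addTwist (D : AffineConnection M) (hP : HasDeg g.deg P) : AffineConnection M :=
  D.addTensor (isTensor_twist (g.isSuperMetric ⊤) hP)

lemma exists_addTwist_eq (D : AffineConnection M) (hP : HasDeg g.deg P) :
    ∃ L : AffineConnection M, L.addTwist hP = D :=
  ⟨D.addTensor (isTensor_twist (g.isSuperMetric ⊤) hP).neg,
    AffineConnection.ext (neg_add_cancel_right D.nabla _)⟩

lemma addTwist_hasSemiSymmetricTorsion_iff (L : AffineConnection M) (hP : HasDeg g.deg P) :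
    (L.addTwist hP).HasSemiSymmetricTorsion g P ↔ L.IsSymmetric :=
  forall₄_congr fun _ _ _ _ => forall₂_congr fun hX hY =>
    torsion_add_twist_iff L.nabla hX hY (bracket hX hY)

lemma addTwist_hasNonMetricity_iff (L : AffineConnection M) (hP : HasDeg g.deg P) :
    (L.addTwist hP).HasNonMetricity g P ↔ L.MetricCompatible g := by
  have iff_of_mem {i j k : ZMod 2} {X Y Z : M.Vect} (hX : HasDeg i X) (hY : HasDeg j Y)
      (hZ : HasDeg k Z) := nonMetricity_add_twist_iff (g.isSuperMetric ⊤) hP L.nabla hX hY hZ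
  refine ⟨fun h i j X Y Z hX hY => ?_, fun h i j k X Y Z hX hY hZ =>
    (iff_of_mem hX hY hZ).2 (h i j X Y Z hX hY)⟩
  induction Z using der_induction with
  | homogeneous k Z hZ => exact (iff_of_mem hX hY hZ).1 (h i j k X Y Z hX hY hZ)
  | add Z Z' hZ hZ' => simp only [SuperMetric.inner, map_add, smul_add, hZ, hZ']; abel

lemma isSemiSymmetricNonMetric_iff_exists (hP : HasDeg g.deg P) {D : AffineConnection M} :
    D.IsSemiSymmetricNonMetric g P ↔
      ∃ L : AffineConnection M, L.IsLeviCivita g ∧ L.addTwist hP = D := by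
  refine exists_congr fun L => and_congr_right fun _ => ⟨fun h => ?_, ?_⟩
  · ext1
    ext1 X
    induction X using der_induction with
    | add X X' h h' => rw [map_add, map_add, h, h']
    | homogeneous i X hX =>
    ext1 Y
    induction Y using der_induction with
    | add Y Y' h h' => rw [map_add, map_add, h, h']
    | homogeneous j Y hY =>
      exact (congrArg (L.nabla X Y + ·) (twist_of_mem hX hY)).trans (h i j X Y hX hY).symm
  · rintro rfl i j X Y hX hY
    exact congrArg (L.nabla X Y + ·) (twist_of_mem hX hY)

lemma hasSemiSymmetricTorsion_and_hasNonMetricity_iff (hP : HasDeg g.deg P)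
    (D : AffineConnection M) :
    D.HasSemiSymmetricTorsion g P ∧ D.HasNonMetricity g P ↔ D.IsSemiSymmetricNonMetric g P := by
  rw [isSemiSymmetricNonMetric_iff_exists hP]
  have iff_isLeviCivita (L : AffineConnection M) :
      (L.addTwist hP).HasSemiSymmetricTorsion g P ∧
        (L.addTwist hP).HasNonMetricity g P ↔ L.IsLeviCivita g :=
    and_congr (L.addTwist_hasSemiSymmetricTorsion_iff hP)
      (L.addTwist_hasNonMetricity_iff hP)
  constructor
  · obtain ⟨L, rfl⟩ := D.exists_addTwist_eq hP
    exact fun hD => ⟨L, (iff_isLeviCivita L).1 hD, rfl⟩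
  · rintro ⟨L, hL, rfl⟩
    exact (iff_isLeviCivita L).2 hL

lemma existsUnique_isSemiSymmetricNonMetric (hP : HasDeg g.deg P) :
    ∃! D : AffineConnection M, D.IsSemiSymmetricNonMetric g P := by
  obtain ⟨L, hL, hL'⟩ := existsUnique_isLeviCivita g
  simp only [isSemiSymmetricNonMetric_iff_exists hP]
  refine ⟨L.addTwist hP, ⟨L, hL, rfl⟩, ?_⟩
  rintro _ ⟨L', hL'', rfl⟩
  rw [hL' L' hL'']

end AffineConnection

end Connections

/-! ### Superderivations of `C^∞(W) ⊗ Λ ℝ^n` -/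

section Smooth

variable {m : ℕ} {V W : Opens (E m)}

/-- Extension by zero of a function on an open subset of `ℝ^m`. -/
def extendZero (f : W → ℝ) : E m → ℝ := Function.extend Subtype.val f 0

lemma extendZero_coe (f : W → ℝ) (x : W) : extendZero f x = f x :=
  Subtype.val_injective.extend_apply f 0 x

lemma contDiffAt_extendZero (f : C^∞⟮𝓘(ℝ, E m), W; ℝ⟯) (x : W) :
    ContDiffAt ℝ ∞ (extendZero f) (x : E m) := by
  rw [← contMDiffAt_iff_contDiffAt, ← contMDiffAt_subtype_iff, funext (extendZero_coe f)]
  exact f.contMDiff x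

lemma differentiableAt_extendZero (f : C^∞⟮𝓘(ℝ, E m), W; ℝ⟯) (x : W) :
    DifferentiableAt ℝ (extendZero f) (x : E m) :=
  (contDiffAt_extendZero f x).differentiableAt (by simp)

lemma fderiv_extendZero {f : W → ℝ} {F : E m → ℝ} (h : ∀ x : W, F x = f x) (x : W) :
    fderiv ℝ (extendZero f) x = fderiv ℝ F x := by
  refine Filter.EventuallyEq.fderiv_eq ?_
  filter_upwards [W.isOpen.mem_nhds x.2] with y hy
  exact (extendZero_coe f ⟨y, hy⟩).trans (h ⟨y, hy⟩).symm

/-- The derivative in the direction `v`, on smooth functions on an open subset of `ℝ^m`. -/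
def partialDeriv (v : E m) :
    Derivation ℝ C^∞⟮𝓘(ℝ, E m), W; ℝ⟯ C^∞⟮𝓘(ℝ, E m), W; ℝ⟯ :=
  Derivation.mk'
    { toFun f := ⟨fun x => fderiv ℝ (extendZero f) x v, fun x => by
        rw [contMDiffAt_subtype_iff (f := fun x => fderiv ℝ (extendZero f) x v),
          contMDiffAt_iff_contDiffAt]
        exact ((contDiffAt_extendZero f x).fderiv_right (m := ∞) (by simp)).clm_apply
          contDiffAt_const⟩
      map_add' f g := by
        ext x
        have h := fderiv_extendZero (f := ⇑(f + g)) (F := extendZero f + extendZero g)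
          (fun x => by simp [extendZero_coe]) x
        rw [fderiv_add (differentiableAt_extendZero f x) (differentiableAt_extendZero g x)] at h
        exact congr($h v)
      map_smul' c f := by
        ext x
        have h := fderiv_extendZero (f := ⇑(c • f)) (F := c • extendZero f)
          (fun x => by simp [extendZero_coe]) x
        rw [fderiv_const_smul (differentiableAt_extendZero f x)] at h
        exact congr($h v) }
    fun f g => by
      ext x
      have h := fderiv_extendZero (f := ⇑(f * g)) (F := extendZero f * extendZero g)
        (fun x => by simp [extendZero_coe]) x
      rw [fderiv_mul (differentiableAt_extendZero f x) (differentiableAt_extendZero g x),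
        extendZero_coe, extendZero_coe] at h
      exact congr($h v)

lemma partialDeriv_apply_of_eq (v : E m) (f : C^∞⟮𝓘(ℝ, E m), W; ℝ⟯) {F : E m → ℝ}
    (h : ∀ x : W, F x = f x) (x : W) : partialDeriv v f x = fderiv ℝ F x v :=
  congr($(fderiv_extendZero h x) v)

lemma smoothRes_partialDeriv (h : V ≤ W) (v : E m) (f : C^∞⟮𝓘(ℝ, E m), W; ℝ⟯) :
    smoothRes h (partialDeriv v f) = partialDeriv v (smoothRes h f) := by
  ext x
  exact (partialDeriv_apply_of_eq v (smoothRes h f) (F := extendZero f)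
    (fun y => extendZero_coe f ⟨y, h y.2⟩) x).symm

/-- The `i`-th coordinate function. -/
def coordFn (i : Fin m) : C^∞⟮𝓘(ℝ, E m), W; ℝ⟯ :=
  ⟨fun x => (EuclideanSpace.proj i : E m →L[ℝ] ℝ) x, fun x => by
    rw [contMDiffAt_subtype_iff (f := (EuclideanSpace.proj i : E m →L[ℝ] ℝ)),
      contMDiffAt_iff_contDiffAt]
    exact (EuclideanSpace.proj i : E m →L[ℝ] ℝ).contDiff.contDiffAt⟩

lemma partialDeriv_coordFn (i : Fin m) :
    partialDeriv (EuclideanSpace.single i 1) (coordFn i : C^∞⟮𝓘(ℝ, E m), W; ℝ⟯) = 1 := by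
  ext x
  rw [partialDeriv_apply_of_eq _ _ (F := (EuclideanSpace.proj i : E m →L[ℝ] ℝ)) (fun x => rfl),
    ContinuousLinearMap.fderiv]
  simp

end Smooth

section Contraction

open CliffordAlgebra

variable {R N : Type*} [CommRing R] [AddCommGroup N] [Module R N] {Q : QuadraticForm R N}

lemma contractLeft_mul_involute (d : Module.Dual R N) (a b : CliffordAlgebra Q) :
    contractLeft d (a * b) = contractLeft d a * b + involute a * contractLeft d b := by
  induction a using CliffordAlgebra.left_induction with
  | algebraMap r =>
    rw [contractLeft_algebraMap, AlgHom.commutes, contractLeft_algebraMap_mul, zero_mul, zero_add]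
  | add x y hx hy =>
    rw [add_mul, map_add, hx, hy, map_add, map_add, add_mul, add_mul]
    abel
  | ι_mul x v hx =>
    rw [mul_assoc, contractLeft_ι_mul, hx, contractLeft_ι_mul, map_mul, involute_ι]
    simp only [mul_add, sub_mul, smul_mul_assoc, neg_mul, mul_assoc]
    abel

lemma contractLeft_mem_evenOdd (d : Module.Dual R N) {j : ZMod 2} {a : CliffordAlgebra Q}
    (ha : a ∈ evenOdd Q j) : contractLeft d a ∈ evenOdd Q (1 + j) := by
  have ι_mul_mem (v : N) {i : ZMod 2} {x : CliffordAlgebra Q} (hx : x ∈ evenOdd Q i) :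
      ι Q v * x ∈ evenOdd Q (1 + i) :=
    SetLike.GradedMul.mul_mem (ι_mem_evenOdd_one Q v) hx
  induction a, ha using CliffordAlgebra.evenOdd_induction with
  | range_ι_pow v h =>
    rcases parity_cases j with rfl | rfl
    · obtain ⟨r, rfl⟩ := Submodule.mem_one.1 (by simpa using h)
      rw [contractLeft_algebraMap]
      exact zero_mem _
    · obtain ⟨w, rfl⟩ : v ∈ LinearMap.range (ι Q) := by simpa [ZMod.val_one] using h
      rw [contractLeft_ι, CharTwo.add_self_eq_zero]
      exact SetLike.algebraMap_mem_graded (evenOdd Q) _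
  | add x y _ _ ihx ihy => exact map_add (contractLeft d) x y ▸ add_mem ihx ihy
  | ι_mul_ι_mul v w x hx ih =>
    have h := ι_mul_mem v (ι_mul_mem w ih)
    rw [← add_assoc 1 1, CharTwo.add_self_eq_zero, zero_add] at h
    rw [mul_assoc, contractLeft_ι_mul, contractLeft_ι_mul, mul_sub, mul_smul_comm]
    exact sub_mem (Submodule.smul_mem _ _ (ι_mul_mem w hx))
      (sub_mem (Submodule.smul_mem _ _ (ι_mul_mem v hx)) h)

lemma contractLeft_mul (d : Module.Dual R N) {j : ZMod 2} {a : CliffordAlgebra Q}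
    (ha : a ∈ evenOdd Q j) (b : CliffordAlgebra Q) :
    contractLeft d (a * b) = contractLeft d a * b + sgn 1 j • (a * contractLeft d b) := by
  rw [contractLeft_mul_involute]
  rcases parity_cases j with rfl | rfl
  · rw [involute_eq_of_mem_even ha, sgn_zero_right, one_smul]
  · rw [involute_eq_of_mem_odd ha, sgn_one_one, neg_smul, one_smul, neg_mul]

end Contraction

section ModelDerivations

open CliffordAlgebra

variable {m n : ℕ} {W : Opens (E m)} {i j : ZMod 2}

/-- The quadratic form `0`, whose Clifford algebra is the exterior algebra. -/
abbrev zeroForm (n : ℕ) : QuadraticForm ℝ (Fin n → ℝ) := 0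

lemma tmul_mem_modelGr (f : C^∞⟮𝓘(ℝ, E m), W; ℝ⟯) {τ : ExteriorAlgebra ℝ (Fin n → ℝ)}
    (hτ : τ ∈ evenOdd (zeroForm n) j) : (f ⊗ₜ[ℝ] τ : Model m n W) ∈ modelGr m n W j :=
  ⟨f ⊗ₜ ⟨τ, hτ⟩, rfl⟩

lemma tmul_one_mem_modelGr (f : C^∞⟮𝓘(ℝ, E m), W; ℝ⟯) :
    (f ⊗ₜ[ℝ] 1 : Model m n W) ∈ modelGr m n W 0 :=
  tmul_mem_modelGr f (SetLike.GradedOne.one_mem (A := evenOdd (zeroForm n)))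

@[elab_as_elim]
lemma modelGr_induction {p : (a : Model m n W) → a ∈ modelGr m n W j → Prop}
    (zero : p 0 (zero_mem _)) (add : ∀ a b ha hb, p a ha → p b hb → p (a + b) (add_mem ha hb))
    (tmul : ∀ f τ (hτ : τ ∈ evenOdd (zeroForm n) j), p (f ⊗ₜ τ) (tmul_mem_modelGr f hτ))
    (a : Model m n W) (ha : a ∈ modelGr m n W j) : p a ha := by
  obtain ⟨t, rfl⟩ := ha
  induction t using TensorProduct.induction_on with
  | zero => simpa only [map_zero] using zero
  | tmul f τ => exact tmul f τ.1 τ.2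
  | add x y hx hy => simpa only [map_add] using add _ _ _ _ hx hy

lemma codisjoint_modelGr : Codisjoint (modelGr m n W 0) (modelGr m n W 1) := by
  refine codisjoint_iff.2 (Submodule.eq_top_iff'.2 fun a => ?_)
  induction a using TensorProduct.induction_on with
  | zero => exact zero_mem _
  | tmul f τ =>
    obtain ⟨τ₀, τ₁, h₀, h₁, rfl⟩ :=
      Submodule.codisjoint_iff_exists_add_eq.1 (evenOdd_isCompl (zeroForm n)).codisjoint τ
    rw [TensorProduct.tmul_add]
    exact Submodule.add_mem_sup (tmul_mem_modelGr f h₀) (tmul_mem_modelGr f h₁)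
  | add x y hx hy => exact add_mem hx hy

lemma mem_derDeg_modelGr {δ : Model m n W →ₗ[ℝ] Model m n W}
    (deg : ∀ j (f : C^∞⟮𝓘(ℝ, E m), W; ℝ⟯), ∀ τ ∈ evenOdd (zeroForm n) j,
      δ (f ⊗ₜ τ) ∈ modelGr m n W (i + j))
    (leibniz : ∀ j (f h : C^∞⟮𝓘(ℝ, E m), W; ℝ⟯), ∀ τ ∈ evenOdd (zeroForm n) j,
      ∀ η : ExteriorAlgebra ℝ (Fin n → ℝ), δ (f ⊗ₜ τ * h ⊗ₜ η) =
        δ (f ⊗ₜ τ) * h ⊗ₜ η + sgn i j • (f ⊗ₜ τ * δ (h ⊗ₜ η))) :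
    δ ∈ derDeg (modelGr m n W) i := by
  refine ⟨fun j a ha => ?_, fun j a ha b => ?_⟩
  · induction a, ha using modelGr_induction with
    | zero => rw [map_zero]; exact zero_mem _
    | add a b _ _ ha hb => rw [map_add]; exact add_mem ha hb
    | tmul f τ hτ => exact deg j f τ hτ
  · induction a, ha using modelGr_induction with
    | zero => simp
    | add a b _ _ ha hb => rw [add_mul, map_add, ha, hb, map_add, add_mul, add_mul, smul_add]; abel
    | tmul f τ hτ =>
      induction b using TensorProduct.induction_on with
      | zero => simp
      | add a b ha hb => rw [mul_add, map_add, ha, hb, map_add, mul_add, mul_add, smul_add]; abel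
      | tmul h η => exact leibniz j f h τ hτ η

variable (n W) in
/-- The even derivation `∂_v ⊗ id`. -/
def evenDeriv (v : E m) : Model m n W →ₗ[ℝ] Model m n W :=
  LinearMap.rTensor _ (partialDeriv v).toLinearMap

variable (W) in
/-- The odd derivation `id ⊗ (d ⌋ ·)`. -/
def oddDeriv (d : Module.Dual ℝ (Fin n → ℝ)) : Model m n W →ₗ[ℝ] Model m n W :=
  LinearMap.lTensor _ (contractLeft (Q := zeroForm n) d)

lemma evenDeriv_tmul (v : E m) (f : C^∞⟮𝓘(ℝ, E m), W; ℝ⟯) (τ : ExteriorAlgebra ℝ (Fin n → ℝ)) :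
    evenDeriv n W v (f ⊗ₜ τ) = partialDeriv v f ⊗ₜ τ := rfl

lemma oddDeriv_tmul (d : Module.Dual ℝ (Fin n → ℝ)) (f : C^∞⟮𝓘(ℝ, E m), W; ℝ⟯)
    (τ : ExteriorAlgebra ℝ (Fin n → ℝ)) :
    oddDeriv W d (f ⊗ₜ τ) = f ⊗ₜ contractLeft (Q := zeroForm n) d τ := rfl

lemma evenDeriv_mem_derDeg (v : E m) : evenDeriv n W v ∈ derDeg (modelGr m n W) 0 := by
  refine mem_derDeg_modelGr (fun j f τ hτ => ?_) fun j f h τ _ η => ?_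
  · rw [zero_add]
    exact tmul_mem_modelGr _ hτ
  · rw [sgn_zero_left, one_smul, Algebra.TensorProduct.tmul_mul_tmul, evenDeriv_tmul,
      evenDeriv_tmul, evenDeriv_tmul, Algebra.TensorProduct.tmul_mul_tmul,
      Algebra.TensorProduct.tmul_mul_tmul, Derivation.leibniz, smul_eq_mul, smul_eq_mul,
      TensorProduct.add_tmul, add_comm, mul_comm h]

lemma oddDeriv_mem_derDeg (d : Module.Dual ℝ (Fin n → ℝ)) :
    oddDeriv W d ∈ derDeg (modelGr m n W) 1 := by
  refine mem_derDeg_modelGr (fun j f τ hτ => ?_) fun j f h τ hτ η => ?_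
  · exact tmul_mem_modelGr _ (contractLeft_mem_evenOdd d hτ)
  · rw [Algebra.TensorProduct.tmul_mul_tmul, oddDeriv_tmul, oddDeriv_tmul, oddDeriv_tmul,
      Algebra.TensorProduct.tmul_mul_tmul, Algebra.TensorProduct.tmul_mul_tmul,
      contractLeft_mul d hτ, TensorProduct.tmul_add, TensorProduct.tmul_smul]

end ModelDerivations

/-! ### Consequences of metric compatibility -/

section SkewForm

variable {A : Type u} [Ring A] [Algebra ℝ A] {𝒜 : ZMod 2 → Submodule ℝ A} [SuperCommAlg 𝒜]
  {d : ZMod 2} {g : der 𝒜 →+ der 𝒜 →+ A} {P : der 𝒜}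

/-- The form `α` on superderivations satisfies `α(Y) Z + (-1)^{|Y||Z|} α(Z) Y = 0` for homogeneous
`Y, Z`. If the semi-symmetric non-metric connection is metric compatible, then `⟨-, P⟩` does. -/
def IsSkewForm (α : der 𝒜 → A) : Prop :=
  ∀ (j k : ZMod 2) (Y Z : der 𝒜), Y.1 ∈ derDeg 𝒜 j → Z.1 ∈ derDeg 𝒜 k →
    α Y • Z + sgn j k • α Z • Y = 0

lemma IsSuperMetric.isSkewForm (hg : IsSuperMetric 𝒜 d g) (hP : P.1 ∈ derDeg 𝒜 d)
    (h : ∀ (i j k : ZMod 2) (X Y Z : der 𝒜), X.1 ∈ derDeg 𝒜 i → Y.1 ∈ derDeg 𝒜 j →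
      Z.1 ∈ derDeg 𝒜 k →
        sgn i j • (g Y P * g X Z) + (sgn i j * sgn k (i + j)) • (g Z P * g Y X) = 0) :
    IsSkewForm fun Y => g Y P := by
  intro j k Y Z hY hZ
  refine hg.ext_right fun i X hX => ?_
  beta_reduce
  rw [map_zero, ← h i j k X Y Z hX hY hZ, map_add, map_zsmul (g X),
    hg.smul_right (hg.apply_mem hP hY) hX, hg.smul_right (hg.apply_mem hP hZ) hX,
    hg.symm _ _ _ _ hX hY, mul_smul_comm, smul_smul, smul_smul]
  congr 2
  clear * -
  decide +revert

namespace IsSkewForm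

variable {B : Type*} [Ring B] [Algebra ℝ B] {α : der 𝒜 → A} {j k : ZMod 2} {Y D : der 𝒜}

lemma map_apply_add (hα : IsSkewForm α) (r : A →ₐ[ℝ] B) (hY : Y.1 ∈ derDeg 𝒜 j)
    (hD : D.1 ∈ derDeg 𝒜 k) (h : A) :
    r (α Y) * r (D.1 h) + sgn j k • (r (α D) * r (Y.1 h)) = 0 := by
  have h0 : α Y * D.1 h + sgn j k • (α D * Y.1 h) = 0 :=
    LinearMap.congr_fun (congrArg Subtype.val (hα j k Y D hY hD)) h
  rw [← map_mul, ← map_mul, ← map_zsmul, ← map_add, h0, map_zero]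

lemma map_eq_zero_of_map_eq_zero (hα : IsSkewForm α) (r : A →ₐ[ℝ] B) (hD : D.1 ∈ derDeg 𝒜 k)
    {h : A} (hDh : r (D.1 h) = 1) (hαD : r (α D) = 0) (hY : Y.1 ∈ derDeg 𝒜 j) : r (α Y) = 0 := by
  simpa only [hDh, hαD, mul_one, zero_mul, smul_zero, add_zero] using hα.map_apply_add r hY hD h

lemma map_eq_zero_of_even (hα : IsSkewForm α) (r : A →ₐ[ℝ] B) (hD : D.1 ∈ derDeg 𝒜 0) {h : A}
    (hDh : r (D.1 h) = 1) (hY : Y.1 ∈ derDeg 𝒜 j) : r (α Y) = 0 := by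
  refine hα.map_eq_zero_of_map_eq_zero r hD hDh (two_zsmul_cancel ?_) hY
  simpa only [hDh, mul_one, sgn_zero_left, one_smul, two_smul, add_zero] using
    hα.map_apply_add r hD hD h

lemma map_eq_zero_of_two_odd (hα : IsSkewForm α) (r : A →ₐ[ℝ] B) {D' : der 𝒜}
    (hD : D.1 ∈ derDeg 𝒜 1) (hD' : D'.1 ∈ derDeg 𝒜 1) {h h' : A} (hDh : r (D.1 h) = 1)
    (hDh' : r (D'.1 h') = 1) (hDh'' : r (D.1 h') = 0) (hY : Y.1 ∈ derDeg 𝒜 j) : r (α Y) = 0 := by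
  refine hα.map_eq_zero_of_map_eq_zero r hD hDh ?_ hY
  simpa only [hDh', hDh'', mul_one, mul_zero, smul_zero, add_zero] using
    hα.map_apply_add r hD hD' h'

end IsSkewForm

end SkewForm

/-! ### Isolated points with at most one odd coordinate -/

section IsolatedPoint

variable {A : Type u} [Ring A] [Algebra ℝ A] {𝒜 : ZMod 2 → Submodule ℝ A} [SuperCommAlg 𝒜]
  {d : ZMod 2} {g : der 𝒜 →+ der 𝒜 →+ A} {f : A}

lemma mul_comm_of_even (hf : f ∈ 𝒜 0) (k : A) : f * k = k * f := by
  induction k using homogeneous_induction 𝒜 with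
  | homogeneous j k hk => rw [SuperCommAlg.super_comm 0 j f hf k hk, sgn_zero_left, one_smul]
  | add k k' h h' => rw [mul_add, add_mul, h, h']

lemma der_apply_mul_of_even (Y : der 𝒜) (hf : f ∈ 𝒜 0) (k : A) :
    Y.1 (f * k) = Y.1 f * k + f * Y.1 k := by
  induction Y using der_induction with
  | homogeneous i Y hY => rw [hY.2 0 f hf, sgn_zero_right, one_smul]
  | add Y Y' h h' =>
    simp only [Submodule.coe_add, LinearMap.add_apply, h, h', add_mul, mul_add, add_add_add_comm]

lemma der_apply_idempotent (Y : der 𝒜) (hf : f ∈ 𝒜 0) (hff : IsIdempotentElem f) :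
    Y.1 f = 0 := by
  have h : Y.1 f = f * Y.1 f + f * Y.1 f := by
    nth_rw 1 [← hff.eq]
    rw [der_apply_mul_of_even Y hf, mul_comm_of_even hf]
  have hfY : f * Y.1 f = 0 := by
    have h' := congrArg (f * ·) h
    simp only [mul_add, ← mul_assoc, hff.eq] at h'
    exact left_eq_add.1 h'
  rw [h, hfY, add_zero]

lemma mul_der_apply (Y : der 𝒜) (hf : f ∈ 𝒜 0) (hff : IsIdempotentElem f) (k : A) :
    f * Y.1 k = Y.1 (f * k) := by
  rw [der_apply_mul_of_even Y hf, der_apply_idempotent Y hf hff, zero_mul, zero_add]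

lemma smul_eq_smul_of_expansion (hf : f ∈ 𝒜 0) (hff : IsIdempotentElem f) {D : der 𝒜} {θ : A}
    (hθ : ∀ k : A, ∃ r s : ℝ, f * k = r • f + s • (f * θ) ∧ f * D.1 k = s • f) (Y : der 𝒜) :
    f • Y = (f * Y.1 θ) • D := by
  refine Subtype.ext (LinearMap.ext fun k => ?_)
  obtain ⟨r, s, hk, hDk⟩ := hθ k
  calc f * Y.1 k
      = s • (f * Y.1 θ) := by
        rw [mul_der_apply Y hf hff, hk, map_add, map_smul, map_smul, der_apply_idempotent Y hf hff,
          smul_zero, zero_add, mul_der_apply Y hf hff]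
    _ = f * Y.1 θ * D.1 k := by
        rw [mul_comm_of_even hf, mul_assoc, hDk, mul_smul_comm]

lemma IsSuperMetric.mul_eq_zero_of_smul_mem_span_odd (hg : IsSuperMetric 𝒜 d g) (hf : f ∈ 𝒜 0)
    (hff : IsIdempotentElem f) {D : der 𝒜} (hD : D.1 ∈ derDeg 𝒜 1)
    (hfD : ∀ Y : der 𝒜, ∃ a : A, f • Y = a • D) {k : ZMod 2} (Y : der 𝒜) {Z : der 𝒜}
    (hZ : Z.1 ∈ derDeg 𝒜 k) : f * g Y Z = 0 := by
  have hDD : g D D = 0 := two_zsmul_cancel <| by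
    rw [two_smul, smul_zero]
    nth_rw 1 [hg.symm _ _ _ _ hD hD]
    rw [sgn_one_one, neg_one_smul, neg_add_cancel]
  have hDZ : f * g D Z = 0 := by
    obtain ⟨b, hb⟩ := hfD Z
    rw [hg.symm _ _ _ _ hD hZ, mul_smul_comm, ← hg.smul, hb, hg.smul, hDD, mul_zero, smul_zero]
  obtain ⟨a, ha⟩ := hfD Y
  calc f * g Y Z = f * g (f • Y) Z := by rw [hg.smul, ← mul_assoc, hff.eq]
    _ = a * (f * g D Z) := by rw [ha, hg.smul, ← mul_assoc, mul_comm_of_even hf, mul_assoc]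
    _ = 0 := by rw [hDZ, mul_zero]

end IsolatedPoint

/-! ### Gluing and extension by zero -/

namespace SuperRingedSpace

variable {M : SuperRingedSpace.{u}} {U O V : Opens M.carrier}

lemma res_res (hVU : V ≤ U) (hOV : O ≤ V) (s : M.sec U) :
    M.res hOV (M.res hVU s) = M.res (hOV.trans hVU) s := by
  have h : M.sheaf.presheaf.map (homOfLE (hOV.trans hVU)).op =
      M.sheaf.presheaf.map (homOfLE hVU).op ≫ M.sheaf.presheaf.map (homOfLE hOV).op := by
    rw [← Functor.map_comp]; rfl
  exact (ConcreteCategory.congr_hom h s).symm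

lemma res_mem (h : V ≤ U) {i : ZMod 2} {s : M.sec U} (hs : s ∈ M.gr U i) :
    M.res h s ∈ M.gr V i :=
  M.map_gr h i s hs

lemma eq_of_locally_res_eq {s t : M.sec ⊤}
    (h : ∀ p : M.carrier, ∃ V : Opens M.carrier, p ∈ V ∧ M.res (V := V) le_top s = M.res le_top t) :
    s = t := by
  choose V hV hst using h
  exact M.sheaf.eq_of_locally_eq' V ⊤ (fun _ => homOfLE le_top)
    (fun p _ => Opens.mem_iSup.2 ⟨p, hV p⟩) s t hst

lemma eq_of_res_eq_res (hUO : U ⊔ O = ⊤) {s t : M.sec ⊤}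
    (hU : M.res (V := U) le_top s = M.res le_top t)
    (hO : M.res (V := O) le_top s = M.res le_top t) : s = t :=
  M.sheaf.eq_of_locally_eq₂ (homOfLE le_top) (homOfLE le_top) hUO.ge s t hU hO

lemma exists_res_eq_and_res_eq (hUO : U ⊔ O = ⊤) (s : M.sec U) (t : M.sec O)
    (h : M.res (inf_le_left : U ⊓ O ≤ U) s = M.res (inf_le_right : U ⊓ O ≤ O) t) :
    ∃ r : M.sec ⊤, M.res le_top r = s ∧ M.res le_top r = t := by
  let F (b : Bool) : Opens M.carrier := cond b U O
  let σ (b : Bool) : M.sec (F b) := match b with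
    | true => s
    | false => t
  have h' : M.res (inf_le_left : O ⊓ U ≤ O) t = M.res (inf_le_right : O ⊓ U ≤ U) s := by
    simpa only [res_res] using (congrArg (M.res (inf_comm O U).le) h).symm
  have hF : ⊤ ≤ iSup F := hUO ▸ sup_le (le_iSup F true) (le_iSup F false)
  have hσ : M.sheaf.presheaf.IsCompatible F σ := by
    rintro (_ | _) (_ | _)
    exacts [rfl, h', h, rfl]
  obtain ⟨r, hr, -⟩ := M.sheaf.existsUnique_gluing' F ⊤ (fun _ => homOfLE le_top) hF σ hσ
  exact ⟨r, hr true, hr false⟩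

lemma mem_gr_of_res_mem (hUO : U ⊔ O = ⊤) {i : ZMod 2} {s : M.sec ⊤}
    (hU : M.res (V := U) le_top s ∈ M.gr U i) (hO : M.res (V := O) le_top s ∈ M.gr O i) :
    s ∈ M.gr ⊤ i := by
  obtain ⟨a, ha, b, hb, rfl⟩ := exists_add_eq (M.gr ⊤) i s
  rw [map_add] at hU hO
  have h : b = 0 := eq_of_res_eq_res hUO
    ((eq_zero_of_add_mem (res_mem _ ha) (res_mem _ hb) hU).trans (map_zero _).symm)
    ((eq_zero_of_add_mem (res_mem _ ha) (res_mem _ hb) hO).trans (map_zero _).symm)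
  rwa [h, add_zero]

/-- An even section `ρ` over `U` that vanishes on `U ∩ O`, where `U` and `O` cover the space. -/
structure Cutoff (M : SuperRingedSpace.{u}) (U : Opens M.carrier) where
  ρ : M.sec U
  ρ_mem : ρ ∈ M.gr U 0
  O : Opens M.carrier
  cover : U ⊔ O = ⊤
  res_ρ : M.res (inf_le_left : U ⊓ O ≤ U) ρ = 0

namespace Cutoff

variable (χ : Cutoff M U) {s : M.sec U} {i : ZMod 2}

lemma exists_extend (s : M.sec U) :
    ∃ r : M.sec ⊤, M.res le_top r = χ.ρ * s ∧ M.res (V := χ.O) le_top r = 0 :=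
  exists_res_eq_and_res_eq χ.cover _ _ (by rw [map_mul, χ.res_ρ, zero_mul, map_zero])

/-- Multiplication by the cutoff section, followed by extension by zero. -/
def extend : M.sec U →ₗ[ℝ] M.sec ⊤ :=
  have res_choose (s) := (χ.exists_extend s).choose_spec.1
  have res_choose' (s) := (χ.exists_extend s).choose_spec.2
  { toFun := fun s => (χ.exists_extend s).choose
    map_add' := fun s t => eq_of_res_eq_res χ.cover
      (by rw [map_add, res_choose, res_choose, res_choose, mul_add])
      (by rw [map_add, res_choose', res_choose', res_choose', add_zero])
    map_smul' := fun c s => eq_of_res_eq_res χ.cover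
      (by rw [RingHom.id_apply, map_smul, res_choose, res_choose, mul_smul_comm])
      (by rw [RingHom.id_apply, map_smul, res_choose', res_choose', smul_zero]) }

lemma res_extend (s : M.sec U) : M.res le_top (χ.extend s) = χ.ρ * s :=
  (χ.exists_extend s).choose_spec.1

lemma res_extend_eq_zero (s : M.sec U) : M.res (V := χ.O) le_top (χ.extend s) = 0 :=
  (χ.exists_extend s).choose_spec.2

lemma extend_mem (hs : s ∈ M.gr U i) : χ.extend s ∈ M.gr ⊤ i := by
  refine mem_gr_of_res_mem χ.cover ?_ ?_
  · rw [χ.res_extend]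
    simpa only [zero_add] using SetLike.GradedMul.mul_mem χ.ρ_mem hs
  · rw [χ.res_extend_eq_zero]
    exact zero_mem _

/-- The extension of a superderivation over `U`, multiplied by the cutoff section, by zero. -/
def extendDer (δ : M.sec U →ₗ[ℝ] M.sec U) : M.sec ⊤ →ₗ[ℝ] M.sec ⊤ :=
  χ.extend ∘ₗ δ ∘ₗ (M.res le_top).toLinearMap

lemma extendDer_apply (δ : M.sec U →ₗ[ℝ] M.sec U) (a : M.sec ⊤) :
    χ.extendDer δ a = χ.extend (δ (M.res le_top a)) := rfl

variable {δ : M.sec U →ₗ[ℝ] M.sec U}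

lemma extendDer_mem_derDeg (hδ : δ ∈ derDeg (M.gr U) i) :
    χ.extendDer δ ∈ derDeg (M.gr ⊤) i := by
  refine ⟨fun j a ha => χ.extend_mem (hδ.1 j _ (res_mem _ ha)), fun j a ha b => ?_⟩
  refine eq_of_res_eq_res χ.cover ?_ ?_
  · have hρ : M.res le_top a * χ.ρ = χ.ρ * M.res le_top a := (mul_comm_of_even χ.ρ_mem _).symm
    simp only [extendDer_apply, map_add, map_zsmul, map_mul, χ.res_extend,
      hδ.2 j _ (res_mem le_top ha), ← mul_assoc, hρ]
  · simp only [extendDer_apply, map_add, map_zsmul, map_mul, χ.res_extend_eq_zero, zero_mul,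
      mul_zero, smul_zero, add_zero]

lemma res_extendDer_extend (hδ : δ ∈ derDeg (M.gr U) i) (hV : V ≤ U) (hρ : M.res hV χ.ρ = 1)
    (hδρ : M.res hV (δ χ.ρ) = 0) (s : M.sec U) :
    M.res le_top (χ.extendDer δ (χ.extend s)) = M.res hV (δ s) := by
  rw [← res_res le_top hV, extendDer_apply, χ.res_extend, χ.res_extend, hδ.2 0 _ χ.ρ_mem,
    sgn_zero_right, one_smul, map_mul, map_add, map_mul, map_mul, hρ, hδρ, zero_mul, zero_add,
    one_mul, one_mul]

end Cutoff

end SuperRingedSpace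

/-! ### Sections and superderivations in a superchart -/

namespace SuperChart

variable {M : SuperRingedSpace.{u}} {m n : ℕ} (c : SuperChart M m n)

/-- The open subset of `M` that corresponds to `W ⊆ ℝ^m` in a superchart. -/
abbrev dom (W : Opens (E m)) : Opens M.carrier :=
  ⟨c.toHomeo.source ∩ c.toHomeo ⁻¹' W, c.toHomeo.isOpen_inter_preimage W.isOpen⟩

/-- The target of a superchart, as an open set. -/
abbrev target : Opens (E m) := ⟨c.toHomeo.target, c.toHomeo.open_target⟩

variable {c}

section Transport

variable {V W : Opens (E m)} (hW : W ≤ c.target) {i : ZMod 2}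

lemma dom_mono (h : V ≤ W) : c.dom V ≤ c.dom W :=
  Set.inter_subset_inter_right _ (Set.preimage_mono h)

lemma res_iso (h : V ≤ W) (a : Model m n W) :
    M.res (dom_mono h) (c.iso W hW a) = c.iso V (h.trans hW) (modelRes n h a) :=
  (c.iso_res V W h hW a).symm

lemma symm_mem_modelGr {s : M.sec (c.dom W)} (hs : s ∈ M.gr (c.dom W) i) :
    (c.iso W hW).symm s ∈ modelGr m n W i := by
  obtain ⟨a, ha, b, hb, hab⟩ := exists_add_eq_of_codisjoint codisjoint_modelGr i
    ((c.iso W hW).symm s)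
  rw [AlgEquiv.eq_symm_apply, map_add] at hab
  have h : c.iso W hW b = 0 :=
    eq_zero_of_add_mem (c.iso_gr W hW i a ha) (c.iso_gr W hW (i + 1) b hb) (hab ▸ hs)
  rwa [← hab, h, add_zero, AlgEquiv.symm_apply_apply]

/-- The linear endomorphism of the sections over `c.dom W` that corresponds to an endomorphism of
`C^∞(W) ⊗ Λ ℝ^n`. -/
def transport (δ : Model m n W →ₗ[ℝ] Model m n W) : M.sec (c.dom W) →ₗ[ℝ] M.sec (c.dom W) :=
  (c.iso W hW).toLinearEquiv.conj δ

lemma transport_iso (δ : Model m n W →ₗ[ℝ] Model m n W) (a : Model m n W) :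
    transport hW δ (c.iso W hW a) = c.iso W hW (δ a) :=
  congrArg (fun b => c.iso W hW (δ b)) ((c.iso W hW).symm_apply_apply a)

lemma transport_mem_derDeg {δ : Model m n W →ₗ[ℝ] Model m n W} (hδ : δ ∈ derDeg (modelGr m n W) i) :
    transport hW δ ∈ derDeg (M.gr (c.dom W)) i := by
  refine ⟨fun j a ha => c.iso_gr W hW _ _ (hδ.1 j _ (symm_mem_modelGr hW ha)),
    fun j a ha b => ?_⟩
  obtain ⟨a, rfl⟩ := (c.iso W hW).surjective a
  obtain ⟨b, rfl⟩ := (c.iso W hW).surjective b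
  have ha' : a ∈ modelGr m n W j := by
    simpa only [AlgEquiv.symm_apply_apply] using symm_mem_modelGr hW ha
  rw [← map_mul, transport_iso, transport_iso, transport_iso, hδ.2 j a ha', map_add, map_zsmul,
    map_mul, map_mul]

end Transport

section Compl

variable [T2Space M.carrier] {K : Set (E m)} (hK : IsCompact K) (hKc : K ⊆ c.toHomeo.target)

/-- The complement in `M` of a compact set in the target of a superchart. -/
def compl : Opens M.carrier :=
  ⟨(c.toHomeo.symm '' K)ᶜ,
    (hK.image_of_continuousOn (c.toHomeo.continuousOn_symm.mono hKc)).isClosed.isOpen_compl⟩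

lemma dom_target_sup_compl : c.dom c.target ⊔ compl hK hKc = ⊤ := by
  refine eq_top_iff.2 fun x _ => or_iff_not_imp_right.2 fun hx => ?_
  obtain ⟨y, hy, rfl⟩ := not_not.1 hx
  have hy' : c.toHomeo.symm y ∈ c.toHomeo.source := c.toHomeo.map_target (hKc hy)
  exact ⟨hy', c.toHomeo.map_source hy'⟩

lemma dom_target_inf_compl_le :
    c.dom c.target ⊓ compl hK hKc ≤
      c.dom ⟨c.toHomeo.target \ K, c.toHomeo.open_target.sdiff hK.isClosed⟩ :=
  fun _ ⟨⟨hx, hx'⟩, hxK⟩ => ⟨hx, hx', fun h => hxK ⟨_, h, c.toHomeo.left_inv hx⟩⟩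

lemma res_iso_tmul_eq_zero {f : C^∞⟮𝓘(ℝ, E m), c.target; ℝ⟯} (hf : ∀ x, x.1 ∉ K → f x = 0)
    (τ : ExteriorAlgebra ℝ (Fin n → ℝ)) :
    M.res (inf_le_left : c.dom c.target ⊓ compl hK hKc ≤ _) (c.iso c.target le_rfl (f ⊗ₜ τ)) =
      0 := by
  let W : Opens (E m) := ⟨c.toHomeo.target \ K, c.toHomeo.open_target.sdiff hK.isClosed⟩
  have hW : W ≤ c.target := Set.sdiff_subset
  have hfW : smoothRes hW f = 0 := by
    ext x
    exact hf _ x.2.2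
  have hfτ : modelRes n hW (f ⊗ₜ τ) = 0 := by
    rw [modelRes, Algebra.TensorProduct.map_tmul, hfW, TensorProduct.zero_tmul]
  rw [← res_res (dom_mono hW) (dom_target_inf_compl_le hK hKc), res_iso le_rfl hW, hfτ, map_zero,
    map_zero]

end Compl

end SuperChart

lemma exists_smooth_cutoff {m : ℕ} {T : Opens (E m)} {x : E m} (hx : x ∈ T) :
    ∃ (K : Set (E m)) (V : Opens (E m)) (hV : V ≤ T) (ρ : C^∞⟮𝓘(ℝ, E m), T; ℝ⟯), IsCompact K ∧
      K ⊆ T ∧ x ∈ V ∧ smoothRes hV ρ = 1 ∧ ∀ y, y.1 ∉ K → ρ y = 0 := by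
  obtain ⟨ε, hε, hT⟩ := Metric.nhds_basis_closedBall.mem_iff.1 (T.isOpen.mem_nhds hx)
  let b : ContDiffBump x := ⟨ε / 2, ε, by positivity, by linarith⟩
  have hV : Metric.ball x (ε / 2) ⊆ T :=
    (Metric.ball_subset_closedBall.trans (Metric.closedBall_subset_closedBall (by linarith))).trans
      hT
  refine ⟨Metric.closedBall x ε, ⟨Metric.ball x (ε / 2), Metric.isOpen_ball⟩, hV,
    ⟨fun y => b y, fun y => ?_⟩, isCompact_closedBall x ε, hT,
    Metric.mem_ball_self (by positivity), ?_, fun y hy => ?_⟩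
  · rw [contMDiffAt_subtype_iff (f := b), contMDiffAt_iff_contDiffAt]
    exact b.contDiffAt
  · ext y
    exact b.one_of_mem_closedBall (Metric.ball_subset_closedBall y.2)
  · exact b.zero_of_le_dist (not_le.1 hy).le

/-! ### Sections over a point with at most one odd coordinate -/

section Point

variable {n : ℕ} [Subsingleton (Fin n)]

lemma eq_sum_smul_one (v : Fin n → ℝ) : v = (∑ i, v i) • 1 := by
  ext i
  rw [Fintype.sum_subsingleton _ i, Pi.smul_apply, Pi.one_apply, smul_eq_mul, mul_one]

lemma exists_exteriorAlgebra_eq (τ : ExteriorAlgebra ℝ (Fin n → ℝ)) :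
    ∃ r s : ℝ, τ = r • 1 + s • ExteriorAlgebra.ι ℝ 1 := by
  induction τ using ExteriorAlgebra.induction with
  | algebraMap r => exact ⟨r, 0, by rw [zero_smul, add_zero, Algebra.algebraMap_eq_smul_one]⟩
  | ι v => exact ⟨0, ∑ i, v i, by rw [zero_smul, zero_add, ← map_smul, ← eq_sum_smul_one]⟩
  | add a b ha hb =>
    obtain ⟨r, s, rfl⟩ := ha
    obtain ⟨r', s', rfl⟩ := hb
    exact ⟨r + r', s + s', by rw [add_smul, add_smul, add_add_add_comm]⟩
  | mul a b ha hb =>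
    obtain ⟨r, s, rfl⟩ := ha
    obtain ⟨r', s', rfl⟩ := hb
    refine ⟨r * r', s * r' + r * s', ?_⟩
    simp only [add_mul, mul_add, smul_mul_smul_comm, one_mul, mul_one, ExteriorAlgebra.ι_sq_zero,
      smul_zero, add_zero, add_smul, add_assoc]

lemma exists_model_eq {W : Opens (E 0)} (x : W) (a : Model 0 n W) :
    ∃ r s : ℝ, a = r • 1 + s • 1 ⊗ₜ ExteriorAlgebra.ι ℝ 1 := by
  induction a using TensorProduct.induction_on with
  | zero => exact ⟨0, 0, by rw [zero_smul, zero_smul, add_zero]⟩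
  | add a b ha hb =>
    obtain ⟨r, s, rfl⟩ := ha
    obtain ⟨r', s', rfl⟩ := hb
    exact ⟨r + r', s + s', by rw [add_smul, add_smul, add_add_add_comm]⟩
  | tmul f τ =>
    obtain ⟨r, s, rfl⟩ := exists_exteriorAlgebra_eq τ
    obtain ⟨t, rfl⟩ : ∃ t : ℝ, f = t • 1 := by
      refine ⟨f x, ContMDiffMap.ext fun y => ?_⟩
      rw [Subsingleton.elim y x]
      exact (mul_one _).symm
    refine ⟨t * r, t * s, ?_⟩
    rw [TensorProduct.smul_tmul, smul_add, TensorProduct.tmul_add, smul_smul, smul_smul,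
      TensorProduct.tmul_smul, TensorProduct.tmul_smul, ← Algebra.TensorProduct.one_def]

end Point

/-! ### Extension of coordinate vector fields -/

/-- Data for extending sections and superderivations from a superchart around `p` to `M`: a cutoff
section that corresponds to a smooth function `ρ₀` which is `1` on the neighbourhood `V` of `p`. -/
structure LocalExtension {m n : ℕ} (M : SuperManifold.{u} m n) (p : M.carrier) where
  c : SuperChart M.toSuperRingedSpace m n
  χ : Cutoff M.toSuperRingedSpace (c.dom c.target)
  ρ₀ : C^∞⟮𝓘(ℝ, E m), c.target; ℝ⟯
  ρ_eq : χ.ρ = c.iso c.target le_rfl (ρ₀ ⊗ₜ 1)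
  V : Opens (E m)
  le : V ≤ c.target
  mem : p ∈ c.dom V
  one : smoothRes le ρ₀ = 1

namespace LocalExtension

open SuperChart

variable {m n : ℕ} {M : SuperManifold.{u} m n} {p : M.carrier}

instance : Nonempty (LocalExtension M p) := by
  have := M.t2
  obtain ⟨c, hp⟩ := M.exists_chart p
  obtain ⟨K, V, hV, ρ, hK, hKc, hx, hρ, hρK⟩ := exists_smooth_cutoff (T := c.target)
    (c.toHomeo.map_source hp)
  exact ⟨⟨c, ⟨_, c.iso_gr _ _ _ _ (tmul_one_mem_modelGr ρ), compl hK hKc,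
    dom_target_sup_compl hK hKc, res_iso_tmul_eq_zero hK hKc hρK 1⟩, ρ, rfl, V, hV, ⟨hp, hx⟩, hρ⟩⟩

variable (F : LocalExtension M p)

/-- Sections of `ℝ^{m|n}` as sections of `M`, over the chart domain. -/
abbrev chartIso : Model m n F.c.target ≃ₐ[ℝ] M.sec (F.c.dom F.c.target) :=
  F.c.iso F.c.target le_rfl

/-- The global function on `M` that agrees near `p` with a section of `ℝ^{m|n}`. -/
def lift (a : Model m n F.c.target) : M.Fn := F.χ.extend (F.chartIso a)

variable {F} {i : ZMod 2}

variable {δ : Model m n F.c.target →ₗ[ℝ] Model m n F.c.target}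

variable (F) in
/-- The global vector field on `M` that agrees near `p` with a homogeneous superderivation of
sections of `ℝ^{m|n}`. -/
def liftDer (hδ : δ ∈ derDeg (modelGr m n F.c.target) i) : M.Vect :=
  ⟨F.χ.extendDer (transport le_rfl δ),
    derDeg_le_der (F.χ.extendDer_mem_derDeg (transport_mem_derDeg le_rfl hδ))⟩

lemma liftDer_mem_derDeg (hδ : δ ∈ derDeg (modelGr m n F.c.target) i) :
    (F.liftDer hδ).1 ∈ derDeg (M.gr ⊤) i :=
  F.χ.extendDer_mem_derDeg (transport_mem_derDeg le_rfl hδ)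

lemma res_liftDer_lift (hδ : δ ∈ derDeg (modelGr m n F.c.target) i)
    (hδρ : modelRes n F.le (δ (F.ρ₀ ⊗ₜ 1)) = 0) (a : Model m n F.c.target) :
    M.res le_top ((F.liftDer hδ).1 (F.lift a)) = F.c.iso F.V F.le (modelRes n F.le (δ a)) := by
  have hρ : M.res (dom_mono F.le) F.χ.ρ = 1 := by
    rw [F.ρ_eq, res_iso le_rfl F.le, modelRes, Algebra.TensorProduct.map_tmul, F.one, map_one,
      ← Algebra.TensorProduct.one_def, map_one]
  have hρ' : M.res (dom_mono F.le) (transport le_rfl δ F.χ.ρ) = 0 := by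
    rw [F.ρ_eq, transport_iso, res_iso le_rfl F.le, hδρ, map_zero]
  exact (F.χ.res_extendDer_extend (transport_mem_derDeg le_rfl hδ) (dom_mono F.le) hρ hρ' _).trans
    (by rw [transport_iso, res_iso le_rfl F.le])

variable (F)

/-- A global vector field that is `∂/∂xⁱ` near `p`. -/
def evenField (i : Fin m) : M.Vect :=
  F.liftDer (evenDeriv_mem_derDeg (EuclideanSpace.single i 1))

lemma res_evenField (i : Fin m) :
    M.res (V := F.c.dom F.V) le_top ((F.evenField i).1 (F.lift (coordFn i ⊗ₜ 1))) = 1 := by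
  rw [evenField, res_liftDer_lift, evenDeriv_tmul, partialDeriv_coordFn]
  · rw [← Algebra.TensorProduct.one_def, map_one, map_one]
  · rw [evenDeriv_tmul, modelRes, Algebra.TensorProduct.map_tmul, smoothRes_partialDeriv, F.one,
      Derivation.map_one_eq_zero, TensorProduct.zero_tmul]

/-- A global vector field that contracts the odd coordinates with `d` near `p`. -/
def oddField (d : Module.Dual ℝ (Fin n → ℝ)) : M.Vect :=
  F.liftDer (oddDeriv_mem_derDeg d)

/-- A global function that is the linear combination of the odd coordinates with coefficients `v`
near `p`. -/
def oddFn (v : Fin n → ℝ) : M.Fn := F.lift (1 ⊗ₜ ExteriorAlgebra.ι ℝ v)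

lemma res_oddField (d : Module.Dual ℝ (Fin n → ℝ)) (v : Fin n → ℝ) :
    M.res (V := F.c.dom F.V) le_top ((F.oddField d).1 (F.oddFn v)) = d v • 1 := by
  have hdv : CliffordAlgebra.contractLeft (Q := zeroForm n) d (ExteriorAlgebra.ι ℝ v) =
      d v • 1 :=
    (CliffordAlgebra.contractLeft_ι _ d v).trans (Algebra.algebraMap_eq_smul_one _)
  rw [oddField, oddFn, res_liftDer_lift, oddDeriv_tmul]
  · rw [hdv, TensorProduct.tmul_smul, ← Algebra.TensorProduct.one_def, map_smul, map_smul,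
      map_one, map_one]
  · rw [oddDeriv_tmul, CliffordAlgebra.contractLeft_one, TensorProduct.tmul_zero, map_zero]

end LocalExtension

/-! ### The vanishing of `⟨-, P⟩` -/

section Point

variable {n : ℕ} {M : SuperManifold.{u} 0 n} {p : M.carrier} (F : LocalExtension M p)

namespace LocalExtension

lemma dom_target_le : F.c.dom F.c.target ≤ F.c.dom F.V := fun x hx =>
  ⟨hx.1, (Subsingleton.elim (F.c.toHomeo p) (F.c.toHomeo x) ▸ F.mem.2 : F.c.toHomeo x ∈ F.V)⟩

lemma χ_ρ_eq_one : F.χ.ρ = 1 := by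
  have h : F.ρ₀ = 1 := by
    ext x
    have hx : x.1 ∈ F.V := Subsingleton.elim (F.c.toHomeo p) x.1 ▸ F.mem.2
    exact congrArg (fun f => f ⟨x.1, hx⟩) F.one
  rw [F.ρ_eq, h, ← Algebra.TensorProduct.one_def, map_one]

/-- The locally constant function that is `1` at `p` and `0` at the other points. -/
def atPoint : M.Fn := F.χ.extend 1

lemma atPoint_mem : F.atPoint ∈ M.gr ⊤ 0 :=
  F.χ.extend_mem SetLike.GradedOne.one_mem

lemma res_atPoint : M.res (V := F.c.dom F.c.target) le_top F.atPoint = 1 :=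
  (F.χ.res_extend 1).trans (by rw [F.χ_ρ_eq_one, one_mul])

lemma atPoint_mul_eq {s t : M.Fn}
    (h : M.res (V := F.c.dom F.c.target) le_top s = M.res le_top t) :
    F.atPoint * s = F.atPoint * t := by
  refine eq_of_res_eq_res F.χ.cover ?_ ?_
  · rw [map_mul, map_mul, h]
  · rw [map_mul, map_mul, atPoint, F.χ.res_extend_eq_zero, zero_mul, zero_mul]

lemma isIdempotentElem_atPoint : IsIdempotentElem F.atPoint :=
  (F.atPoint_mul_eq (t := 1) (F.res_atPoint.trans (map_one (M.res le_top)).symm)).trans (mul_one _)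

lemma atPoint_mul_oddField (d : Module.Dual ℝ (Fin n → ℝ)) (v : Fin n → ℝ) :
    F.atPoint * (F.oddField d).1 (F.oddFn v) = d v • F.atPoint := by
  have h : M.res (V := F.c.dom F.c.target) le_top ((F.oddField d).1 (F.oddFn v)) =
      M.res le_top (d v • 1 : M.Fn) := by
    rw [← res_res le_top F.dom_target_le, res_oddField, map_smul, map_smul, map_one, map_one]
  rw [F.atPoint_mul_eq h, mul_smul_comm, mul_one]

variable [Subsingleton (Fin n)]

lemma exists_atPoint_mul_eq (k : M.Fn) :
    ∃ r s : ℝ, F.atPoint * k = r • F.atPoint + s • (F.atPoint * F.oddFn 1) := by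
  obtain ⟨r, s, hrs⟩ := exists_model_eq ⟨_, F.le F.mem.2⟩ (F.chartIso.symm (M.res le_top k))
  refine ⟨r, s, ?_⟩
  have h : M.res (V := F.c.dom F.c.target) le_top k = M.res le_top (r • 1 + s • F.oddFn 1) := by
    rw [map_add, map_smul, map_smul, map_one, oddFn, lift, F.χ.res_extend, F.χ_ρ_eq_one, one_mul,
      ← map_one F.chartIso, ← map_smul, ← map_smul, ← map_add, ← hrs, AlgEquiv.apply_symm_apply]
  rw [F.atPoint_mul_eq h, mul_add, mul_smul_comm, mul_smul_comm, mul_one]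

variable (n) in
/-- The sum of the coordinates. -/
def coordSum : Module.Dual ℝ (Fin n → ℝ) := ∑ i, LinearMap.proj i

lemma exists_atPoint_expansion (k : M.Fn) :
    ∃ r s : ℝ, F.atPoint * k = r • F.atPoint + s • (F.atPoint * F.oddFn 1) ∧
      F.atPoint * (F.oddField (coordSum n)).1 k = s • F.atPoint := by
  obtain ⟨r, s, hk⟩ := F.exists_atPoint_mul_eq k
  have hθ : coordSum n 1 • F.oddFn 1 = F.oddFn 1 := by
    have h1 : coordSum n 1 • (1 : Fin n → ℝ) = 1 := by
      rw [coordSum, LinearMap.sum_apply]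
      exact (eq_sum_smul_one 1).symm
    rw [oddFn, lift, ← map_smul, ← map_smul, ← TensorProduct.tmul_smul, ← map_smul, h1]
  refine ⟨r, s * coordSum n 1, ?_, ?_⟩
  · rw [hk, mul_smul, ← mul_smul_comm (coordSum n 1), hθ]
  · rw [mul_der_apply _ F.atPoint_mem F.isIdempotentElem_atPoint, hk, map_add, map_smul, map_smul,
      der_apply_idempotent _ F.atPoint_mem F.isIdempotentElem_atPoint, smul_zero, zero_add,
      ← mul_der_apply _ F.atPoint_mem F.isIdempotentElem_atPoint, atPoint_mul_oddField, mul_smul]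

end LocalExtension

end Point

section Vanishing

open LocalExtension

variable {m n : ℕ} {M : SuperManifold.{u} m n} {g : SuperMetric M} {P : M.Vect}

lemma exists_res_inner_eq_zero (hP : HasDeg g.deg P) (h : IsSkewForm fun Y => g.form ⊤ Y P)
    {j : ZMod 2} {Y : M.Vect} (hY : HasDeg j Y) (p : M.carrier) :
    ∃ V : Opens M.carrier, p ∈ V ∧ M.res (V := V) le_top (g.form ⊤ Y P) = 0 := by
  obtain ⟨F⟩ : Nonempty (LocalExtension M p) := inferInstance
  refine ⟨F.c.dom F.V, F.mem, ?_⟩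
  rcases m.eq_zero_or_pos with rfl | hm
  · rcases subsingleton_or_nontrivial (Fin n) with hn | hn
    · have hf : F.atPoint * g.form ⊤ Y P = 0 :=
        (g.isSuperMetric ⊤).mul_eq_zero_of_smul_mem_span_odd F.atPoint_mem
          F.isIdempotentElem_atPoint (liftDer_mem_derDeg _)
          (fun Y => ⟨_, smul_eq_smul_of_expansion F.atPoint_mem F.isIdempotentElem_atPoint
            F.exists_atPoint_expansion Y⟩) Y hP
      have hres := congrArg (M.res (V := F.c.dom F.V) le_top) hf
      rwa [map_mul, map_zero, ← res_res le_top (SuperChart.dom_mono F.le) F.atPoint, F.res_atPoint,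
        map_one, one_mul] at hres
    · obtain ⟨a, b, hab⟩ := exists_pair_ne (Fin n)
      refine h.map_eq_zero_of_two_odd (M.res le_top) (D := F.oddField (LinearMap.proj a))
        (D' := F.oddField (LinearMap.proj b)) (liftDer_mem_derDeg _) (liftDer_mem_derDeg _)
        (h := F.oddFn (Pi.single a 1)) (h' := F.oddFn (Pi.single b 1)) ?_ ?_ ?_ hY <;>
      simp [F.res_oddField, hab]
  · exact h.map_eq_zero_of_even (M.res le_top) (liftDer_mem_derDeg _) (F.res_evenField ⟨0, hm⟩) hY

lemma not_metricCompatible {D : AffineConnection M} (hP : HasDeg g.deg P) (hP0 : P ≠ 0)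
    (hD : D.HasNonMetricity g P) : ¬ D.MetricCompatible g := by
  intro hD'
  have hg := g.isSuperMetric ⊤
  have h : IsSkewForm fun Y => g.form ⊤ Y P := hg.isSkewForm hP fun i j k X Y Z hX hY hZ => by
    have hXYZ := hD i j k X Y Z hX hY hZ
    rwa [← hD' i j X Y Z hX hY, add_assoc, left_eq_add] at hXYZ
  refine hP0 (hg.ext_right fun j Y hY => eq_of_locally_res_eq fun p => ?_)
  obtain ⟨V, hpV, hV⟩ := exists_res_inner_eq_zero hP h hY p
  exact ⟨V, hpV, by rw [hV, map_zero, map_zero]⟩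

end Vanishing

end SuperGeometry

end

theorem theorem2p14 {m n : ℕ} (M : SuperGeometry.SuperManifold.{u} m n)
    (g : SuperGeometry.SuperMetric M) (P : M.Vect)
    (hP : SuperGeometry.SuperRingedSpace.HasDeg g.deg P) :
    (∃! D : SuperGeometry.AffineConnection M,
      D.HasSemiSymmetricTorsion g P ∧ D.HasNonMetricity g P) ∧
    (∀ D : SuperGeometry.AffineConnection M,
      D.HasSemiSymmetricTorsion g P ∧ D.HasNonMetricity g P ↔
        D.IsSemiSymmetricNonMetric g P) ∧
    (P ≠ 0 → ∀ D : SuperGeometry.AffineConnection M,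
      D.HasSemiSymmetricTorsion g P ∧ D.HasNonMetricity g P → ¬ D.MetricCompatible g) :=
  ⟨by simpa only [SuperGeometry.AffineConnection.hasSemiSymmetricTorsion_and_hasNonMetricity_iff hP]
      using SuperGeometry.AffineConnection.existsUnique_isSemiSymmetricNonMetric hP,
    SuperGeometry.AffineConnection.hasSemiSymmetricTorsion_and_hasNonMetricity_iff hP,
    fun hP0 _ hD => SuperGeometry.not_metricCompatible hP hP0 hD.2⟩
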